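/- Let $c\in\mathbb{C}\setminus\{0\}$ and consider on $\mathbb{C}\setminus\{0\}$ the potential \[ \xi=\lambda^{-1}\begin{pmatrix}0&1\\ c z^{-1}&0\end{pmatrix}dz ,\qquad \lambda\in\mathbb{S}^1=\{\lambda\in\mathbb{C}: |\lambda|=1\}. \] Let $\Lambda SL_2\mathbb{C}_\sigma$ be the group of smooth maps $\mathbb{S}^1\to SL_2\mathbb{C}$ whose diagonal entries are even and whose off-diagonal entries are odd in $\lambda$, let $\Lambda G_\sigma$ be its subgroup of maps into a subgroup $G$ of $SL_2\mathbb{C}$, and let $\Lambda_+SL_2\mathbb{C}_\sigma$ be its subgroup of loops that extend to the closed unit disk as $SL_2\mathbb{C}$-valued maps, smooth up to the boundary and holomorphic inside. Put $\omega=\begin{pmatrix}0&-\lambda\\ \lambda^{-1}&0\end{pmatrix}$ and $\sigma_3=\mathrm{diag}(1,-1)$. Let $\Sigma\subset\mathbb{C}\setminus\{0\}$ be an annular domain (an open set homeomorphic to a round open annulus) containing a closed curve with nonzero winding number about $0$, and let $\tilde\Sigma$ be its universal cover. Let $G$ be one of $SU(2)$, $SU(1,1)$, $SL_2\mathbb{R}$,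 let $L:\tilde\Sigma\to\Lambda SL_2\mathbb{C}_\sigma$ be any solution of $dL=L\xi$, and suppose that $L$ has an Iwasawa splitting on $\tilde\Sigma$, that is, $L=F_0B$ on $\tilde\Sigma$ or, when $G=SU(1,1)$, $L=F_0\,\omega B$ on $\tilde\Sigma$, with $F_0:\tilde\Sigma\to\Lambda G_\sigma$ smooth in $(z,\lambda)$ and $B:\tilde\Sigma\to\Lambda_+SL_2\mathbb{C}_\sigma$. Let $F=F_0$ in the first case and $F=\omega^{-1}F_0\,\omega$ in the second, and define $f=f_\lambda$ on $\tilde\Sigma$ by \[ f=\frac{-i}{2H}\left[F\sigma_3F^{-1}-2\lambda(\partial_\lambda F)F^{-1}\right]\quad (H\in\mathbb{R}\setminus\{0\}) \] if $G=SU(2)$ (CMC $H$ surfaces in $\mathbb{R}^3$) or $G=SU(1,1)$ (spacelike CMC $H$ surfaces in Minkowski space $\mathbb{L}^3$), and by \[ f=-i\,\lambda(\partial_\lambda F)F^{-1} \] if $G=SL_2\mathbb{R}$ (timelike surfaces of constant negative Gauss curvature in $\mathbb{L}^3$). Here $\mathbb{R}^3$ and $\mathbb{L}^3$ are identified with the Lie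 algebra of $G$, and $\lambda\partial_\lambda=-i\partial_t$ for $\lambda=e^{it}$. Then for no value $\lambda_0\in\mathbb{S}^1$ is the resulting immersion $f_{\lambda_0}$ well defined on $\Sigma$: there is no map on $\Sigma$ whose pull-back to $\tilde\Sigma$ is $f_{\lambda_0}$. (For $G=SL_2\mathbb{R}$ it is assumed that $f_{\lambda_0}$ is an immersion on $\tilde\Sigma$; for the other two groups no such assumption is made.) -/

import Mathlib

open scoped ContDiff

noncomputable section

namespace DPW

/-- Complex `2 × 2` matrices. -/
abbrev Mat2 : Type := Matrix (Fin 2) (Fin 2) ℂ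

/-- Matrix-valued maps on the unit circle `|λ| = 1`. -/
abbrev Loop : Type := Circle → Mat2

/-- The matrix `diag (1, -1)`. -/
def sigma3 : Mat2 := !![1, 0; 0, -1]

/-- Smoothness of a loop, in the angle `t` of `λ = exp (i t)`. -/
def IsSmoothLoop (g : Loop) : Prop :=
  ∀ i j, ContDiff ℝ ∞ (fun t : ℝ => g (Circle.exp t) i j)

/-- The loop is twisted: the diagonal entries are even and the off-diagonal entries are odd in `λ`.
Here `Circle.exp Real.pi * l` is the point `-l` of the circle. -/
def IsTwisted (g : Loop) : Prop :=
  ∀ l : Circle,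
    g (Circle.exp Real.pi * l) 0 0 = g l 0 0 ∧ g (Circle.exp Real.pi * l) 1 1 = g l 1 1 ∧
    g (Circle.exp Real.pi * l) 0 1 = -g l 0 1 ∧ g (Circle.exp Real.pi * l) 1 0 = -g l 1 0

/-- The twisted loop group of smooth maps from the circle to `SL(2, ℂ)`. -/
def loopSL2 : Set Loop :=
  {g | IsSmoothLoop g ∧ IsTwisted g ∧ ∀ l, (g l).det = 1}

/-- The positive twisted loop group (not normalized at `λ = 0`): the loops that extend to the
closed unit disk as `SL(2, ℂ)`-valued maps, smooth up to the boundary and holomorphic inside. -/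
def loopPlus : Set Loop :=
  {g | g ∈ loopSL2 ∧ ∃ E : ℂ → Mat2,
    (∀ i j, ContDiffOn ℝ ∞ (fun z => E z i j) (Metric.closedBall 0 1)) ∧
    (∀ i j, DifferentiableOn ℂ (fun z => E z i j) (Metric.ball 0 1)) ∧
    (∀ z ∈ Metric.closedBall (0 : ℂ) 1, (E z).det = 1) ∧
    ∀ l : Circle, E (l : ℂ) = g l}

/-- The three surface classes: constant mean curvature surfaces in Euclidean 3-space, spacelike
constant mean curvature surfaces in Minkowski 3-space, and timelike surfaces of constant negative
Gauss curvature in Minkowski 3-space. -/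
inductive SurfaceClass : Type
  | cmcEuclidean
  | cmcSpacelike
  | cgcTimelike

/-- The real form of `SL(2, ℂ)` that belongs to a surface class: `SU(2)`, `SU(1,1)`, `SL(2, ℝ)`. -/
def realForm : SurfaceClass → Set Mat2
  | .cmcEuclidean => {A | A.det = 1 ∧ A.conjTranspose * A = 1}
  | .cmcSpacelike => {A | A.det = 1 ∧ A.conjTranspose * sigma3 * A = sigma3}
  | .cgcTimelike => {A | A.det = 1 ∧ ∀ i j, (A i j).im = 0}

/-- The twisted loop group of a real form. -/
def loopReal (T : SurfaceClass) : Set Loop :=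
  {g | g ∈ loopSL2 ∧ ∀ l, g l ∈ realForm T}

/-- The loop `ω` that describes the second open Iwasawa cell of `SU(1,1)`. -/
def omega : Loop := fun l => !![0, -(l : ℂ); (l : ℂ)⁻¹, 0]

/-- The coefficient of `dz` in the potential `ξ = λ⁻¹ (0, 1; c z⁻¹, 0) dz`. -/
def potential (c : ℂ) (l : Circle) (z : ℂ) : Mat2 :=
  (l : ℂ)⁻¹ • !![0, 1; c * z⁻¹, 0]

/-- The closed path `γ` in `ℂ \ {0}` has winding number `n` about `0`: along a continuous
logarithm, the end value exceeds the initial value by `2 π i n`. -/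
def HasWindingNumber {z : ℂ} (γ : Path z z) (n : ℤ) : Prop :=
  ∃ θ : C(unitInterval, ℂ), (∀ t, Complex.exp (θ t) = γ t) ∧
    θ 1 - θ 0 = 2 * Real.pi * Complex.I * n

/-- `S` is an annular domain in `ℂ \ {0}` (an open set homeomorphic to a round annulus) that
contains a loop with nonzero winding number about `0`. -/
def IsAnnularAroundZero (S : Set ℂ) : Prop :=
  IsOpen S ∧ (0 : ℂ) ∉ S ∧ Nonempty (S ≃ₜ {z : ℂ // 1 < ‖z‖ ∧ ‖z‖ < 2}) ∧
    ∃ (z : ℂ) (γ : Path z z) (n : ℤ), (∀ t, γ t ∈ S) ∧ HasWindingNumber γ n ∧ n ≠ 0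

/-- The universal cover of an annular domain `S` around `0`, in the coordinate `w = log z`:
the covering map is `w ↦ z = exp w`, the deck transformations are `w ↦ w + 2 π i k`. -/
def logCover (S : Set ℂ) : Set ℂ := Complex.exp ⁻¹' S

/-- `L` is a solution of `dL = L ξ` with values in the twisted loop group, on the set `U` of values
of the coordinate `w = log z`; the pull-back of `dz` is `exp w dw`. -/
def IsSolution (c : ℂ) (U : Set ℂ) (L : ℂ → Loop) : Prop :=
  (∀ w ∈ U, L w ∈ loopSL2) ∧
  ∀ w ∈ U, ∀ l : Circle, ∀ i j,
    HasDerivAt (fun v => L v l i j)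
      ((L w l * (Complex.exp w • potential c l (Complex.exp w))) i j) w

/-- A family of loops over `U` that is smooth in `(w, λ)`. -/
def IsSmoothFamily (U : Set ℂ) (F : ℂ → Loop) : Prop :=
  ∀ i j, ContDiffOn ℝ ∞ (fun p : ℂ × ℝ => F p.1 (Circle.exp p.2) i j) (U ×ˢ Set.univ)

/-- `F` is an extended frame obtained from `L` by Iwasawa splitting over `U`: either `L = F B`, or,
for `SU(1,1)` only, `L = F₀ ω B` and `F = ω⁻¹ F₀ ω`, with the real factor in the loop group of the
real form, smooth over `U`, and `B` in the positive loop group. -/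
def IsFrame (T : SurfaceClass) (U : Set ℂ) (L F : ℂ → Loop) : Prop :=
  ∃ F₀ B : ℂ → Loop,
    IsSmoothFamily U F₀ ∧ (∀ w ∈ U, F₀ w ∈ loopReal T) ∧ (∀ w ∈ U, B w ∈ loopPlus) ∧
    ((∀ w ∈ U, ∀ l, L w l = F₀ w l * B w l ∧ F w l = F₀ w l) ∨
      (T = .cmcSpacelike ∧ ∀ w ∈ U, ∀ l,
        L w l = F₀ w l * omega l * B w l ∧ F w l = (omega l)⁻¹ * F₀ w l * omega l))

/-- The derivative `λ ∂_λ g` of a smooth loop, that is `-i ∂_t` for `λ = exp (i t)`. -/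
def lambdaDeriv (g : Loop) (l : Circle) : Mat2 :=
  Matrix.of fun i j => -Complex.I * deriv (fun t : ℝ => g (Circle.exp t * l) i j) 0

/-- The Sym-Bobenko formula with mean curvature `H` for the two CMC classes, and the Sym formula
for the timelike class (which does not involve `H`). The values lie in the Lie algebra of the real
form, which is Euclidean or Minkowski 3-space. -/
def symMap (H : ℝ) : SurfaceClass → Loop → Loop
  | .cmcEuclidean, g => fun l =>
      (-Complex.I / (2 * H)) • (g l * sigma3 * (g l)⁻¹ - (2 : ℂ) • (lambdaDeriv g l * (g l)⁻¹))
  | .cmcSpacelike, g => fun l =>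
      (-Complex.I / (2 * H)) • (g l * sigma3 * (g l)⁻¹ - (2 : ℂ) • (lambdaDeriv g l * (g l)⁻¹))
  | .cgcTimelike, g => fun l => (-Complex.I) • (lambdaDeriv g l * (g l)⁻¹)

/-- The matrix-valued map `f` is an immersion on the open set `U` of the real plane `ℂ`. -/
def IsImmersionOn (U : Set ℂ) (f : ℂ → Mat2) : Prop :=
  ∀ w ∈ U, DifferentiableAt ℝ (fun v => (fun i j => f v i j : Fin 2 → Fin 2 → ℂ)) w ∧
    Function.Injective (fderiv ℝ (fun v => (fun i j => f v i j : Fin 2 → Fin 2 → ℂ)) w)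

/-- A map `f` on the universal cover of `S` is well defined on `S`: it factors through `S`. -/
def IsWellDefinedOn (S : Set ℂ) (f : ℂ → Mat2) : Prop :=
  ∃ fS : ℂ → Mat2, ∀ w ∈ logCover S, f w = fS (Complex.exp w)

end DPW

end

/-!
Let `τ = 2 π i n` be the period of a loop with winding number `n ≠ 0`. Near `z = 0` the system
`dL = L ξ` has a solution with a logarithm, so that `L(w + τ) = (1 + N) L(w)`, where `N = N_λ` does
not depend on `w`, `N² = 0` and `N ≠ 0` for each `λ`.

Let `P` be the coefficient of `λ⁻¹ dw` in `F⁻¹ dF`. By the Sym formula the differential of `f_λ₀`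
determines `F_λ₀ P F_λ₀⁻¹`, so this matrix has the period `τ` if `f_λ₀` has. Then `F_λ F_λ₀⁻¹`, for
every `λ`, is multiplied on the left by a factor `R_λ` that does not depend on `w` when `w` is
replaced by `w + τ`: with `f_λ₀` the whole associated family closes up to rigid motions.

Hence `B(w)⁻¹ F_λ₀(w)⁻¹ F_λ₀(w + τ) B(w + τ) = L(w)⁻¹ R⁻¹ (1 + N) L(w)`, and the left side extends
holomorphically to the disk `|λ| < 1`. The trace-free part `X` is a Killing field, that is, a
trace-free solution of `dX = [X, α]` in the disk for the potential `α = λ⁻¹ A dw`. The leading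
coefficient in `λ` of a Killing field is a nonzero multiple of `A`, and `A² = c z ≠ 0`, so that the
trace form of two nonzero Killing fields does not vanish. The commutator of two Killing fields is a
Killing field orthogonal to both, hence it is zero. So `X = L⁻¹ Z L` commutes with its translate
`L⁻¹ (1 + N)⁻¹ Z (1 + N) L`, which forces `N = 0` for those `λ` for which `det Z ≠ 0`.
-/

noncomputable section

namespace DPW

open Matrix
open scoped Nat ComplexConjugate ContDiff Matrix.Norms.Operator

/-! ### Derivatives and adjugates of `2 × 2` matrices -/

section Adjugate

variable {R : Type*} [CommRing R]

theorem adjugate_add_fin_two (M N : Matrix (Fin 2) (Fin 2) R) :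
    (M + N).adjugate = M.adjugate + N.adjugate := by
  simp [adjugate_fin_two, add_comm]

theorem adjugate_adjugate_fin_two (M : Matrix (Fin 2) (Fin 2) R) : M.adjugate.adjugate = M := by
  simp [adjugate_fin_two, ← eta_fin_two M]

theorem adjugate_eq_neg_of_trace_eq_zero {M : Matrix (Fin 2) (Fin 2) R} (h : M.trace = 0) :
    M.adjugate = -M := by
  rw [trace_fin_two] at h
  rw [adjugate_fin_two, eq_neg_of_add_eq_zero_left h]
  nth_rw 5 [eta_fin_two M]
  simp [eq_neg_of_add_eq_zero_left h]

theorem mul_self_of_trace_eq_zero {A : Matrix (Fin 2) (Fin 2) R} (hA : A.trace = 0) :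
    A * A = -A.det • (1 : Matrix (Fin 2) (Fin 2) R) := by
  have h := mul_adjugate A
  rw [adjugate_eq_neg_of_trace_eq_zero hA, mul_neg] at h
  rw [neg_smul, ← h, neg_neg]

theorem mul_add_mul_of_trace_eq_zero {A X : Matrix (Fin 2) (Fin 2) R} (hA : A.trace = 0)
    (hX : X.trace = 0) :
    A * X + X * A = (A * X).trace • (1 : Matrix (Fin 2) (Fin 2) R) := by
  rw [trace_fin_two] at hA hX
  rw [eta_fin_two A, eta_fin_two X, eq_neg_of_add_eq_zero_left hA, eq_neg_of_add_eq_zero_left hX]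
  simp only [mul_fin_two, one_fin_two, smul_of, trace_fin_two_of]
  ext i j
  fin_cases i <;> fin_cases j <;> simp <;> ring

theorem mul_adjugate_of_det {M : Matrix (Fin 2) (Fin 2) R} (h : M.det = 1) :
    M * M.adjugate = 1 := by rw [mul_adjugate, h, one_smul]

theorem adjugate_mul_of_det {M : Matrix (Fin 2) (Fin 2) R} (h : M.det = 1) :
    M.adjugate * M = 1 := by rw [adjugate_mul, h, one_smul]

theorem mul_conj_mul_adjugate {M : Matrix (Fin 2) (Fin 2) R} (h : M.det = 1)
    (A : Matrix (Fin 2) (Fin 2) R) : M * (M.adjugate * A * M) * M.adjugate = A := by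
  rw [mul_assoc M.adjugate, ← mul_assoc M, mul_adjugate_of_det h, one_mul, mul_assoc,
    mul_adjugate_of_det h, mul_one]

theorem conj_mul_conj {M : Matrix (Fin 2) (Fin 2) R} (h : M.det = 1)
    (A B : Matrix (Fin 2) (Fin 2) R) :
    (M.adjugate * A * M) * (M.adjugate * B * M) = M.adjugate * (A * B) * M := by
  rw [mul_assoc M.adjugate B, ← mul_assoc _ M.adjugate, mul_assoc _ M, mul_adjugate_of_det h]
  simp only [mul_one, mul_assoc]

theorem inv_eq_adjugate {M : Matrix (Fin 2) (Fin 2) R} (h : M.det = 1) : M⁻¹ = M.adjugate := by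
  rw [Matrix.inv_def, h, Ring.inverse_one, one_smul]

end Adjugate

section MatrixCalculus

variable {𝕜 R : Type*} [NontriviallyNormedField 𝕜] [NormedCommRing R] [NormedAlgebra 𝕜 R]
  {g : 𝕜 → Matrix (Fin 2) (Fin 2) R} {g' : Matrix (Fin 2) (Fin 2) R} {x : 𝕜}

theorem hasDerivAt_matrix :
    HasDerivAt g g' x ↔ ∀ i j, HasDerivAt (fun y => g y i j) (g' i j) x :=
  (hasDerivAt_pi (E' := fun _ => Fin 2 → R)).trans (forall_congr' fun _ => hasDerivAt_pi)

theorem hasDerivAt_adjugate (hg : HasDerivAt g g' x) :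
    HasDerivAt (fun y => (g y).adjugate) g'.adjugate x := by
  rw [hasDerivAt_matrix] at hg ⊢
  simp only [adjugate_fin_two]
  intro i j
  fin_cases i <;> fin_cases j
  · exact hg 1 1
  · exact (hg 0 1).neg
  · exact (hg 1 0).neg
  · exact hg 0 0

theorem trace_adjugate_mul_eq_zero (hg : HasDerivAt g g' x)
    (hdet : ∀ᶠ y in nhds x, (g y).det = 1) : ((g x).adjugate * g').trace = 0 := by
  rw [hasDerivAt_matrix] at hg
  have h1 := ((hg 0 0).mul (hg 1 1)).sub ((hg 0 1).mul (hg 1 0))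
  have h2 : HasDerivAt (fun y => (g y).det) 0 x :=
    (hasDerivAt_const x (1 : R)).congr_of_eventuallyEq hdet
  have h3 := h2.unique (h1.congr_of_eventuallyEq (.of_forall fun y => det_fin_two (g y)))
  rw [trace_fin_two, eta_fin_two g', adjugate_fin_two, mul_fin_two]
  simp only [of_apply, cons_val', cons_val_zero, cons_val_one, cons_val_fin_one]
  linear_combination -h3

theorem hasDerivAt_adjugate_of_det (hg : HasDerivAt g g' x)
    (hdet : ∀ᶠ y in nhds x, (g y).det = 1) :
    HasDerivAt (fun y => (g y).adjugate) (-((g x).adjugate * g' * (g x).adjugate)) x := by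
  have h := adjugate_eq_neg_of_trace_eq_zero (trace_adjugate_mul_eq_zero hg hdet)
  rw [adjugate_mul_distrib, adjugate_adjugate_fin_two] at h
  convert hasDerivAt_adjugate hg using 1
  rw [← neg_mul, ← h, mul_assoc, mul_adjugate_of_det hdet.self_of_nhds, mul_one]

end MatrixCalculus

section TraceFree

variable {K : Type*} [Field K] {A X N : Matrix (Fin 2) (Fin 2) K}

theorem trace_eq_zero_of_mul_self_eq_zero (hN : N * N = 0) : N.trace = 0 :=
  (isNilpotent_trace_of_isNilpotent ⟨2, by rw [sq, hN]⟩).eq_zero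

theorem exists_eq_smul_of_commute [NeZero (2 : K)] (hA : A.trace = 0) (hdet : A.det ≠ 0)
    (hX : X.trace = 0) (h : Commute A X) : ∃ a : K, X = a • A := by
  have hAX : A * X = ((A * X).trace / 2) • (1 : Matrix _ _ K) := by
    have h2 := mul_add_mul_of_trace_eq_zero hA hX
    rw [← h.eq, ← two_smul K] at h2
    rw [div_eq_inv_mul, mul_smul, ← h2, inv_smul_smul₀ two_ne_zero]
  refine ⟨-((A * X).trace / 2) / A.det, ?_⟩
  have h3 : A * (A * X) = ((A * X).trace / 2) • A := by
    nth_rw 1 [hAX]; rw [mul_smul_comm, mul_one]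
  rw [← mul_assoc, mul_self_of_trace_eq_zero hA, smul_mul_assoc, one_mul] at h3
  rw [neg_div, ← div_neg, div_eq_inv_mul, mul_smul, ← h3, inv_smul_smul₀ (neg_ne_zero.2 hdet)]

theorem eq_zero_of_commute_of_mul_self_eq_zero [NeZero (2 : K)] (hX : X.trace = 0)
    (hdet : X.det ≠ 0) (hN : N * N = 0) (h : Commute X N) : N = 0 := by
  obtain ⟨b, rfl⟩ := exists_eq_smul_of_commute hX hdet (trace_eq_zero_of_mul_self_eq_zero hN) h
  rw [smul_mul_smul_comm, mul_self_of_trace_eq_zero hX, smul_smul] at hN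
  have hb : b * b * -X.det = 0 := (smul_eq_zero.1 hN).resolve_right one_ne_zero
  rw [mul_self_eq_zero.1 ((mul_eq_zero.1 hb).resolve_right (neg_ne_zero.2 hdet)), zero_smul]

theorem eq_zero_of_conj_eq_smul (hX : X.trace = 0) (hdet : X.det ≠ 0) (hN : N * N = 0) {a : K}
    (h : (1 - N) * X * (1 + N) = a • X) (ha : a ≠ 1) : N = 0 := by
  have hne : 1 - a ≠ 0 := sub_ne_zero.2 ha.symm
  have hNXN : N * X * N = 0 := by
    have h1 : N * ((1 - N) * X * (1 + N)) * N = N * X * N := by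
      calc _ = N * X * N - N * N * X * N + N * X * (N * N) - N * N * X * (N * N) := by noncomm_ring
        _ = N * X * N := by simp only [hN, zero_mul, mul_zero, sub_zero, add_zero]
    rw [h, mul_smul_comm, smul_mul_assoc] at h1
    refine (smul_eq_zero.1 ?_).resolve_left hne
    rw [sub_smul, one_smul, h1, sub_self]
  have hNX : N * X = 0 := by
    have h1 : N * ((1 - N) * X * (1 + N)) = N * X := by
      calc _ = N * X + N * X * N - N * N * X - N * N * X * N := by noncomm_ring
        _ = N * X := by simp only [hN, hNXN, zero_mul, sub_zero, add_zero]
    rw [h, mul_smul_comm] at h1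
    refine (smul_eq_zero.1 ?_).resolve_left hne
    rw [sub_smul, one_smul, h1, sub_self]
  have h2 : N * X * X = -X.det • N := by
    rw [mul_assoc, mul_self_of_trace_eq_zero hX, mul_smul_comm, mul_one]
  rw [hNX, zero_mul] at h2
  exact (smul_eq_zero.1 h2.symm).resolve_left (neg_ne_zero.2 hdet)

theorem eq_zero_of_commute_conj [NeZero (2 : K)] (hX : X.trace = 0)
    (hdet : X.det ≠ 0) (hN : N * N = 0) (h : Commute X ((1 - N) * X * (1 + N))) : N = 0 := by
  have hNN : (1 + N) * (1 - N) = 1 := by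
    rw [show (1 + N) * (1 - N) = 1 - N * N by noncomm_ring, hN, sub_zero]
  have hY : ((1 - N) * X * (1 + N)).trace = 0 := by
    rw [trace_mul_comm, ← mul_assoc, hNN, one_mul, hX]
  obtain ⟨a, ha⟩ := exists_eq_smul_of_commute hX hdet hY h
  by_cases ha1 : a = 1
  · refine eq_zero_of_commute_of_mul_self_eq_zero hX hdet hN ?_
    have h1 := congrArg ((1 + N) * ·) ha
    simp only [← mul_assoc, hNN, ha1, one_smul, one_mul] at h1
    rw [mul_add, add_mul, mul_one, one_mul] at h1
    exact add_left_cancel h1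
  · exact eq_zero_of_conj_eq_smul hX hdet hN ha ha1

end TraceFree

/-! ### Real forms -/

/-- The conjugate-linear involution of `2 × 2` matrices whose fixed points of determinant one form
the real form of the surface class. It is defined over any commutative star ring, so that it also
applies to matrices of functions of `λ`. -/
def reality {R : Type*} [CommRing R] [StarRing R] :
    SurfaceClass → Matrix (Fin 2) (Fin 2) R → Matrix (Fin 2) (Fin 2) R
  | .cmcEuclidean, M => !![star (M 1 1), -star (M 1 0); -star (M 0 1), star (M 0 0)]
  | .cmcSpacelike, M => !![star (M 1 1), star (M 1 0); star (M 0 1), star (M 0 0)]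
  | .cgcTimelike, M => !![star (M 0 0), star (M 0 1); star (M 1 0), star (M 1 1)]

section Reality

variable {R : Type*} [CommRing R] [StarRing R] (T : SurfaceClass) (M N : Matrix (Fin 2) (Fin 2) R)

theorem reality_add : reality T (M + N) = reality T M + reality T N := by
  cases T <;> simp [reality, add_comm]

theorem reality_neg : reality T (-M) = -reality T M := by
  cases T <;> simp [reality]

theorem reality_cmcEuclidean : reality .cmcEuclidean M = M.adjugateᴴ := by
  ext i j
  fin_cases i <;> fin_cases j <;> simp [reality, adjugate_fin_two, conjTranspose_apply]

theorem reality_cmcSpacelike :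
    reality .cmcSpacelike M = !![1, 0; 0, -1] * M.adjugateᴴ * !![1, 0; 0, -1] := by
  rw [← reality_cmcEuclidean]
  simp [reality]

theorem reality_cgcTimelike : reality .cgcTimelike M = M.map star :=
  (eta_fin_two (M.map star)).symm

theorem reality_mul : reality T (M * N) = reality T M * reality T N := by
  cases T with
  | cmcEuclidean =>
    simp only [reality_cmcEuclidean, adjugate_mul_distrib, conjTranspose_mul]
  | cmcSpacelike =>
    have hJ : (!![1, 0; 0, -1] * !![1, 0; 0, -1] : Matrix (Fin 2) (Fin 2) R) = 1 := by
      simp [one_fin_two]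
    simp only [reality_cmcSpacelike, adjugate_mul_distrib, conjTranspose_mul, mul_assoc]
    rw [← mul_assoc !![1, 0; 0, -1] !![1, 0; 0, -1], hJ, one_mul]
  | cgcTimelike =>
    simp only [reality_cgcTimelike]
    exact Matrix.map_mul (f := starRingEnd R)

theorem reality_smul {S : Type*} [CommRing S] [StarRing S] [Module S R] [StarModule S R] (a : S) :
    reality T (a • M) = star a • reality T M := by
  cases T <;> simp [reality]

theorem reality_adjugate : reality T M.adjugate = (reality T M).adjugate := by
  cases T <;> simp [reality, adjugate_fin_two]

theorem map_reality {S : Type*} [CommRing S] [StarRing S] {f : R → S} {g : R →+ S}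
    (h : ∀ x, g (star x) = star (f x)) : (reality T M).map g = reality T (M.map f) := by
  rw [eta_fin_two ((reality T M).map g)]
  cases T <;> simp [reality, h]

end Reality

theorem sigma3_mul_sigma3 : sigma3 * sigma3 = 1 := by
  simp [sigma3, one_fin_two]

theorem conjTranspose_sigma3 : sigma3ᴴ = sigma3 := by
  ext i j
  fin_cases i <;> fin_cases j <;> simp [sigma3, conjTranspose_apply]

theorem reality_sigma3 {T : SurfaceClass} (hT : T ≠ .cgcTimelike) : reality T sigma3 = -sigma3 := by
  cases T <;> simp_all [reality, sigma3]

theorem reality_eq_of_mem_realForm {T : SurfaceClass} {A : Mat2} (hA : A ∈ realForm T) :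
    reality T A = A := by
  cases T with
  | cmcEuclidean =>
    obtain ⟨hdet, h⟩ := hA
    rw [reality_cmcEuclidean, ← inv_eq_adjugate hdet, inv_eq_left_inv h,
      conjTranspose_conjTranspose]
  | cmcSpacelike =>
    obtain ⟨hdet, h⟩ := hA
    have h1 : Aᴴ * sigma3 = sigma3 * A.adjugate := by
      nth_rw 2 [← h]
      rw [mul_assoc, mul_adjugate_of_det hdet, mul_one]
    have h2 : sigma3 * A = A.adjugateᴴ * sigma3 := by
      simpa [conjTranspose_mul, conjTranspose_sigma3] using congrArg conjTranspose h1
    rw [reality_cmcSpacelike, mul_assoc, ← sigma3, ← h2, ← mul_assoc, sigma3_mul_sigma3, one_mul]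
  | cgcTimelike =>
    rw [reality_cgcTimelike]
    ext i j
    exact Complex.conj_eq_iff_im.2 (hA.2 i j)

theorem reality_omega (l : Circle) : reality .cmcSpacelike (omega l) = -omega l := by
  simp [reality, omega, ← Circle.coe_inv_eq_conj]

theorem hasDerivAt_reality (T : SurfaceClass) {g : ℝ → Mat2} {g' : Mat2} {x : ℝ}
    (hg : HasDerivAt g g' x) : HasDerivAt (fun y => reality T (g y)) (reality T g') x := by
  rw [hasDerivAt_matrix] at hg ⊢
  have hstar := fun i j => (hg i j).star
  intro i j
  cases T <;> fin_cases i <;> fin_cases j <;>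
    first | exact hstar _ _ | exact (hstar _ _).neg

/-! ### Entire functions given by power series in `μ exp w` -/

/-- The power series with coefficients `a` has infinite radius of convergence. -/
def RapidDecay (a : ℕ → ℂ) : Prop := ∀ r : ℝ, 0 ≤ r → Summable fun n => ‖a n‖ * r ^ n

/-- The sum of the power series with coefficients `a`. -/
def entire (a : ℕ → ℂ) (ζ : ℂ) : ℂ := ∑' n, a n * ζ ^ n

/-- The coefficients of `ζ f'(ζ)`, where `f` has the coefficients `a`: the derivation `ζ d/dζ` is
`d/dw` in the coordinate `ζ = μ exp w`. -/
def eulerCoeff (a : ℕ → ℂ) : ℕ → ℂ := fun n => n * a n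

theorem RapidDecay.euler {a : ℕ → ℂ} (h : RapidDecay a) : RapidDecay (eulerCoeff a) := by
  intro r hr
  refine Summable.of_nonneg_of_le (fun n => by positivity) (fun n => ?_)
    (h (2 * r) (by positivity))
  have : (n : ℝ) ≤ 2 ^ n := by exact_mod_cast Nat.lt_two_pow_self.le
  simp only [eulerCoeff, norm_mul, Complex.norm_natCast, mul_pow]
  nlinarith [mul_le_mul_of_nonneg_right this (by positivity : 0 ≤ ‖a n‖ * r ^ n)]

theorem RapidDecay.summable {a : ℕ → ℂ} (h : RapidDecay a) (ζ : ℂ) :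
    Summable fun n => a n * ζ ^ n := by
  refine Summable.of_norm ?_
  simpa only [norm_mul, norm_pow] using h ‖ζ‖ (norm_nonneg _)

theorem RapidDecay.continuous {a : ℕ → ℂ} (h : RapidDecay a) : Continuous (entire a) := by
  rw [continuous_iff_continuousAt]
  intro ζ
  have : ContinuousOn (entire a) (Metric.ball 0 (‖ζ‖ + 1)) := by
    refine continuousOn_tsum (fun n => by fun_prop) (h (‖ζ‖ + 1) (by positivity)) ?_
    intro n x hx
    rw [norm_mul, norm_pow]
    have : ‖x‖ ≤ ‖ζ‖ + 1 := by simpa using (mem_ball_zero_iff.1 hx).le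
    gcongr
  exact this.continuousAt (Metric.isOpen_ball.mem_nhds (by simp))

theorem RapidDecay.hasDerivAt {a : ℕ → ℂ} (h : RapidDecay a) (μ w : ℂ) :
    HasDerivAt (fun w => entire a (μ * Complex.exp w))
      (entire (eulerCoeff a) (μ * Complex.exp w)) w := by
  set r : ℝ := ‖μ‖ * Real.exp (w.re + 1)
  have key := hasDerivAt_tsum_of_isPreconnected
    (u := fun n => ‖eulerCoeff a n‖ * r ^ n) (t := Metric.ball w 1)
    (g := fun n v => a n * (μ * Complex.exp v) ^ n)
    (g' := fun n v => eulerCoeff a n * (μ * Complex.exp v) ^ n) (y₀ := w) (y := w)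
    (h.euler r (by positivity)) Metric.isOpen_ball (convex_ball w 1).isPreconnected ?_ ?_
    (by simp) (h.summable _) (by simp)
  · exact key
  · intro n v _
    have h1 := ((((Complex.hasDerivAt_exp v).const_mul μ).fun_pow n).const_mul (a n))
    refine h1.congr_deriv ?_
    rcases n with _ | n
    · simp [eulerCoeff]
    · simp only [eulerCoeff, Nat.add_sub_cancel]; ring
  · intro n v hv
    rw [norm_mul, norm_pow, norm_mul, Complex.norm_exp]
    have : v.re ≤ w.re + 1 := by
      have h2 := (Complex.abs_re_le_norm (v - w)).trans (mem_ball_iff_norm.1 hv).le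
      rw [Complex.sub_re] at h2
      linarith [le_abs_self (v.re - w.re)]
    have h3 : ‖μ‖ * Real.exp v.re ≤ r := by simp only [r]; gcongr
    gcongr

theorem entire_zero (a : ℕ → ℂ) : entire a 0 = a 0 := by
  rw [entire, tsum_eq_single 0]
  · simp
  · intro n hn; simp [hn]

/-- The coefficients of the power series solution of `x'' = exp w * x` in the variable `exp w`. -/
def regCoeff : ℕ → ℂ := fun n => 1 / (n ! : ℂ) ^ 2

/-- The coefficients of the second solution of `x'' = exp w * x`, which is `w` times the regular
solution plus this power series. By the method of Frobenius they are the derivatives at `r = 0` of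
the coefficients `((r + 1) ⋯ (r + n)) ^ (-2)` of the solution starting with `exp (r w)`. -/
def logCoeff : ℕ → ℂ := fun n => -2 * (harmonic n : ℂ) / (n ! : ℂ) ^ 2

theorem regCoeff_decay : RapidDecay regCoeff := by
  intro r hr
  refine Summable.of_nonneg_of_le (fun n => by positivity) (fun n => ?_)
    (Real.summable_pow_div_factorial r)
  have h1 : (1 : ℝ) ≤ n ! := by exact_mod_cast Nat.one_le_iff_ne_zero.2 (Nat.factorial_ne_zero n)
  have : ‖regCoeff n‖ = 1 / (n ! : ℝ) ^ 2 := by simp [regCoeff]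
  rw [this, div_mul_eq_mul_div, one_mul]
  gcongr
  nlinarith

theorem harmonic_le_self (n : ℕ) : 0 ≤ harmonic n ∧ harmonic n ≤ n := by
  induction n with
  | zero => simp
  | succ n ih =>
    have h1 : 0 ≤ ((n + 1 : ℕ) : ℚ)⁻¹ := by positivity
    have h2 : ((n + 1 : ℕ) : ℚ)⁻¹ ≤ 1 := inv_le_one_of_one_le₀ (by simp)
    rw [harmonic_succ]
    push_cast at *
    constructor <;> linarith

theorem logCoeff_decay : RapidDecay logCoeff := by
  intro r hr
  refine Summable.of_nonneg_of_le (fun n => by positivity) (fun n => ?_)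
    ((regCoeff_decay.euler r hr).mul_left 2)
  have h0 := harmonic_le_self n
  have h1 : ‖(harmonic n : ℂ)‖ ≤ n := by
    have : (harmonic n : ℂ) = ((harmonic n : ℝ) : ℂ) := by push_cast; rfl
    rw [this, Complex.norm_real, Real.norm_eq_abs, abs_of_nonneg (by exact_mod_cast h0.1)]
    exact_mod_cast h0.2
  have h2 : ‖logCoeff n‖ ≤ 2 * ‖eulerCoeff regCoeff n‖ := by
    simp only [logCoeff, eulerCoeff, regCoeff, norm_div, norm_mul, norm_neg, Complex.norm_natCast,
      norm_pow, norm_one, Complex.norm_ofNat]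
    rw [← mul_assoc, mul_one_div]
    gcongr
  rw [← mul_assoc]
  gcongr

theorem entire_succ {a : ℕ → ℂ} (h : RapidDecay a) (ζ : ℂ) :
    entire a ζ = a 0 + ∑' n, a (n + 1) * ζ ^ (n + 1) := by
  rw [entire, (h.summable ζ).tsum_eq_zero_add]; simp

theorem entire_euler_euler_reg (ζ : ℂ) :
    entire (eulerCoeff (eulerCoeff regCoeff)) ζ = ζ * entire regCoeff ζ := by
  rw [entire_succ regCoeff_decay.euler.euler, entire, ← tsum_mul_left]
  simp only [eulerCoeff, regCoeff, Nat.cast_zero, zero_mul, zero_add]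
  congr 1; ext n
  have : (n ! : ℂ) ≠ 0 := by exact_mod_cast n.factorial_ne_zero
  have h1 : ((n : ℂ) + 1) ≠ 0 := by exact_mod_cast n.succ_ne_zero
  rw [Nat.factorial_succ]; push_cast
  field_simp
  ring

theorem entire_euler_euler_log (ζ : ℂ) :
    entire (eulerCoeff (eulerCoeff logCoeff)) ζ =
      ζ * entire logCoeff ζ - 2 * entire (eulerCoeff regCoeff) ζ := by
  rw [entire_succ logCoeff_decay.euler.euler, entire_succ regCoeff_decay.euler]
  simp only [eulerCoeff, Nat.cast_zero, zero_mul, zero_add]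
  rw [entire, ← tsum_mul_left, ← tsum_mul_left, ← Summable.tsum_sub]
  · congr 1; ext n
    have : (n ! : ℂ) ≠ 0 := by exact_mod_cast n.factorial_ne_zero
    have h1 : ((n : ℂ) + 1) ≠ 0 := by exact_mod_cast n.succ_ne_zero
    simp only [logCoeff, regCoeff, harmonic_succ, Nat.factorial_succ]
    push_cast
    field_simp
    ring
  · exact (logCoeff_decay.summable ζ).mul_left ζ
  · exact (((summable_nat_add_iff 1).2 (regCoeff_decay.euler.summable ζ))).mul_left 2

/-! ### The linear system and its monodromy -/

/-- The coefficient matrix of `λ ξ` with respect to `dw`, in the coordinate `w = log z`. -/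
def xiMat (c w : ℂ) : Mat2 := !![0, Complex.exp w; c, 0]

theorem exp_smul_potential (c w : ℂ) (l : Circle) :
    Complex.exp w • potential c l (Complex.exp w) = (l : ℂ)⁻¹ • xiMat c w := by
  have h : Complex.exp w * (c * (Complex.exp w)⁻¹) = c := by
    field_simp [Complex.exp_ne_zero w]
  rw [potential, smul_comm]
  simp [xiMat, h]

theorem trace_xiMat (c w : ℂ) : (xiMat c w).trace = 0 := by
  simp [xiMat, trace_fin_two]

theorem det_xiMat (c w : ℂ) : (xiMat c w).det = -(c * Complex.exp w) := by
  simp [xiMat, mul_comm]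

theorem exp_add_two_pi_mul_I_mul_int (w : ℂ) (n : ℤ) :
    Complex.exp (w + 2 * Real.pi * Complex.I * n) = Complex.exp w :=
  Complex.exp_eq_exp_iff_exists_int.2 ⟨n, by ring⟩

theorem xiMat_add_period (c w : ℂ) (n : ℤ) :
    xiMat c (w + 2 * Real.pi * Complex.I * n) = xiMat c w := by
  rw [xiMat, exp_add_two_pi_mul_I_mul_int, xiMat]

theorem wronskian_eq_one (ζ : ℂ) :
    entire regCoeff ζ * (entire regCoeff ζ + entire (eulerCoeff logCoeff) ζ) -
      entire (eulerCoeff regCoeff) ζ * entire logCoeff ζ = 1 := by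
  set D : ℂ → ℂ := fun ζ =>
    entire regCoeff ζ * (entire regCoeff ζ + entire (eulerCoeff logCoeff) ζ) -
      entire (eulerCoeff regCoeff) ζ * entire logCoeff ζ with hD
  have hDc : Continuous D := by
    have h1 := regCoeff_decay.continuous
    have h2 := regCoeff_decay.euler.continuous
    have h3 := logCoeff_decay.continuous
    have h4 := logCoeff_decay.euler.continuous
    fun_prop
  have hd : ∀ w, HasDerivAt (fun w => D (1 * Complex.exp w)) 0 w := by
    intro w
    have h1 := regCoeff_decay.hasDerivAt 1 w
    have h2 := regCoeff_decay.euler.hasDerivAt 1 w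
    have h3 := logCoeff_decay.hasDerivAt 1 w
    have h4 := logCoeff_decay.euler.hasDerivAt 1 w
    rw [entire_euler_euler_reg] at h2
    rw [entire_euler_euler_log] at h4
    refine ((h1.fun_mul (h1.fun_add h4)).fun_sub (h2.fun_mul h3)).congr_deriv ?_
    ring
  have hconst : ∀ w, D (1 * Complex.exp w) = D (1 * Complex.exp 0) := fun w =>
    is_const_of_deriv_eq_zero (fun w => (hd w).differentiableAt) (fun w => (hd w).deriv) w 0
  have hne : ∀ ζ ∈ ({0}ᶜ : Set ℂ), D ζ = D (1 * Complex.exp 0) := by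
    intro ζ hζ
    rw [← hconst (Complex.log ζ), Complex.exp_log hζ, one_mul]
  have hall : D = fun _ => D (1 * Complex.exp 0) :=
    Continuous.ext_on (dense_compl_singleton 0) hDc continuous_const hne
  have h0 : D 0 = 1 := by
    simp [hD, entire_zero, regCoeff, eulerCoeff]
  calc D ζ = D 0 := by rw [congrFun hall ζ, ← congrFun hall 0]
    _ = 1 := h0

/-- The fundamental solution of `Φ' = λ⁻¹ Φ A`, where `A = xiMat c w`, whose second row has a
logarithm. -/
def fundSol (c : ℂ) (l : Circle) (w : ℂ) : Mat2 :=
  !![entire regCoeff (c * (l : ℂ)⁻¹ ^ 2 * Complex.exp w),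
    (l / c) * entire (eulerCoeff regCoeff) (c * (l : ℂ)⁻¹ ^ 2 * Complex.exp w);
    w * entire regCoeff (c * (l : ℂ)⁻¹ ^ 2 * Complex.exp w) +
      entire logCoeff (c * (l : ℂ)⁻¹ ^ 2 * Complex.exp w),
    (l / c) * (entire regCoeff (c * (l : ℂ)⁻¹ ^ 2 * Complex.exp w) +
      w * entire (eulerCoeff regCoeff) (c * (l : ℂ)⁻¹ ^ 2 * Complex.exp w) +
      entire (eulerCoeff logCoeff) (c * (l : ℂ)⁻¹ ^ 2 * Complex.exp w))]

theorem hasDerivAt_fundSol {c : ℂ} (hc : c ≠ 0) (l : Circle) (w : ℂ) :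
    HasDerivAt (fundSol c l) (fundSol c l w * ((l : ℂ)⁻¹ • xiMat c w)) w := by
  have hl : (l : ℂ) ≠ 0 := l.coe_ne_zero
  have h1 := regCoeff_decay.hasDerivAt (c * (l : ℂ)⁻¹ ^ 2) w
  have h2 := regCoeff_decay.euler.hasDerivAt (c * (l : ℂ)⁻¹ ^ 2) w
  have h3 := logCoeff_decay.hasDerivAt (c * (l : ℂ)⁻¹ ^ 2) w
  have h4 := logCoeff_decay.euler.hasDerivAt (c * (l : ℂ)⁻¹ ^ 2) w
  have h5 := hasDerivAt_id' w
  rw [entire_euler_euler_reg] at h2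
  rw [entire_euler_euler_log] at h4
  rw [hasDerivAt_matrix, mul_smul_comm, fundSol, xiMat, mul_fin_two]
  intro i j
  fin_cases i <;> fin_cases j
  · refine h1.congr_deriv ?_
    simp
    field_simp
  · refine (h2.const_mul ((l : ℂ) / c)).congr_deriv ?_
    simp
    field_simp
  · refine ((h5.fun_mul h1).fun_add h3).congr_deriv ?_
    simp
    field_simp
  · refine (((h1.fun_add (h5.fun_mul h2)).fun_add h4).const_mul ((l : ℂ) / c)).congr_deriv ?_
    simp
    field_simp
    ring

theorem det_fundSol (c : ℂ) (l : Circle) (w : ℂ) : (fundSol c l w).det = l / c := by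
  have := wronskian_eq_one (c * (l : ℂ)⁻¹ ^ 2 * Complex.exp w)
  simp only [fundSol, det_fin_two_of]
  linear_combination (l / c : ℂ) * this

theorem continuous_fundSol (c : ℂ) : Continuous fun p : ℂ × Circle => fundSol c p.2 p.1 := by
  have h1 := regCoeff_decay.continuous
  have h2 := regCoeff_decay.euler.continuous
  have h3 := logCoeff_decay.continuous
  have h4 := logCoeff_decay.euler.continuous
  have h5 : Continuous fun p : ℂ × Circle => c * (p.2 : ℂ)⁻¹ ^ 2 * Complex.exp p.1 := by
    refine (continuous_const.mul (Continuous.pow ?_ 2)).mul (by fun_prop)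
    exact Continuous.inv₀ (by fun_prop) fun p => p.2.coe_ne_zero
  refine continuous_matrix fun i j => ?_
  fin_cases i <;> fin_cases j <;>
    simp only [fundSol, of_apply, cons_val, Fin.zero_eta, Fin.mk_one, Fin.isValue] <;> fun_prop

theorem fundSol_add_period (c : ℂ) (l : Circle) (w : ℂ) (n : ℤ) :
    fundSol c l (w + 2 * Real.pi * Complex.I * n) =
      (1 + (2 * Real.pi * Complex.I * n : ℂ) • !![0, 0; 1, 0]) * fundSol c l w := by
  simp only [fundSol, exp_add_two_pi_mul_I_mul_int, smul_of, one_fin_two]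
  ext i j
  fin_cases i <;> fin_cases j <;> simp [mul_apply, Fin.sum_univ_two] <;> ring

theorem exists_mul_one_add_eq_one_add_mul {R : Type*} [Ring R] {C E : R} (hC : IsUnit C)
    (hE : E ≠ 0) (hEE : E * E = 0) : ∃ N, N ≠ 0 ∧ N * N = 0 ∧ C * (1 + E) = (1 + N) * C := by
  obtain ⟨u, rfl⟩ := hC
  refine ⟨u * E * ↑u⁻¹, by simpa using hE, ?_, ?_⟩
  · calc (u * E * ↑u⁻¹ * (u * E * ↑u⁻¹) : R) = u * (E * E) * ↑u⁻¹ := by simp [mul_assoc]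
      _ = 0 := by rw [hEE, mul_zero, zero_mul]
  · simp [mul_add, add_mul]

section Solution

variable {c : ℂ} {l : Circle} {U : Set ℂ} {L M : ℂ → Mat2}

theorem solution_mul_adjugate_const (hU : IsOpen U) (hUc : IsPreconnected U)
    (hL : ∀ w ∈ U, HasDerivAt L (L w * ((l : ℂ)⁻¹ • xiMat c w)) w)
    (hM : ∀ w ∈ U, HasDerivAt M (M w * ((l : ℂ)⁻¹ • xiMat c w)) w) {w w₀ : ℂ}
    (hw : w ∈ U) (hw₀ : w₀ ∈ U) : L w * (M w).adjugate = L w₀ * (M w₀).adjugate := by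
  have hd : ∀ w ∈ U, HasDerivAt (fun w => L w * (M w).adjugate) 0 w := by
    intro w hw
    refine ((hL w hw).mul (hasDerivAt_adjugate (hM w hw))).congr_deriv ?_
    have h0 : ((l : ℂ)⁻¹ • xiMat c w).adjugate = -((l : ℂ)⁻¹ • xiMat c w) :=
      adjugate_eq_neg_of_trace_eq_zero (by rw [trace_smul, trace_xiMat, smul_zero])
    rw [adjugate_mul_distrib, h0]
    noncomm_ring
  exact hU.is_const_of_deriv_eq_zero hUc
    (fun w hw => (hd w hw).differentiableAt.differentiableWithinAt)
    (fun w hw => (hd w hw).deriv) hw hw₀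

theorem solution_eq_mul_fundSol (hc : c ≠ 0) (hU : IsOpen U) (hUc : IsPreconnected U)
    (hL : ∀ w ∈ U, HasDerivAt L (L w * ((l : ℂ)⁻¹ • xiMat c w)) w) {w w₀ : ℂ}
    (hw : w ∈ U) (hw₀ : w₀ ∈ U) :
    L w = (c / l : ℂ) • (L w₀ * (fundSol c l w₀).adjugate) * fundSol c l w := by
  have hconst := solution_mul_adjugate_const hU hUc hL
    (fun w _ => hasDerivAt_fundSol hc l w) hw hw₀
  have hcl : (c / l : ℂ) * (l / c) = 1 := by field_simp [l.coe_ne_zero]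
  rw [← hconst, smul_mul_assoc, mul_assoc, adjugate_mul, det_fundSol, mul_smul_comm, smul_smul,
    mul_one, hcl, one_smul]

theorem exists_nilpotent_monodromy (hc : c ≠ 0) (hU : IsOpen U) (hUc : IsPreconnected U)
    (hne : U.Nonempty) (hL : ∀ w ∈ U, HasDerivAt L (L w * ((l : ℂ)⁻¹ • xiMat c w)) w)
    (hdet : ∀ w ∈ U, (L w).det = 1) {n : ℤ} (hn : n ≠ 0)
    (hτ : ∀ w ∈ U, w + 2 * Real.pi * Complex.I * n ∈ U) :
    ∃ N : Mat2, N ≠ 0 ∧ N * N = 0 ∧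
      ∀ w ∈ U, L (w + 2 * Real.pi * Complex.I * n) = (1 + N) * L w := by
  obtain ⟨w₀, hw₀⟩ := hne
  obtain ⟨C, hLC⟩ : ∃ C : Mat2, ∀ w ∈ U, L w = C * fundSol c l w :=
    ⟨_, fun w hw => solution_eq_mul_fundSol hc hU hUc hL hw hw₀⟩
  have hC : IsUnit C := (isUnit_iff_isUnit_det C).2 <| isUnit_iff_ne_zero.2 fun h => by
    simpa [h, hdet w₀ hw₀] using congrArg det (hLC w₀ hw₀)
  set E : Mat2 := (2 * Real.pi * Complex.I * n : ℂ) • !![0, 0; 1, 0] with hE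
  have hE0 : E ≠ 0 := fun h => by
    have h10 := congrFun (congrFun h 1) 0
    simp [hE, hn] at h10
  have hEE : E * E = 0 := by
    ext i j
    fin_cases i <;> fin_cases j <;> simp [hE]
  obtain ⟨N, hN0, hNN, hN⟩ := exists_mul_one_add_eq_one_add_mul hC hE0 hEE
  refine ⟨N, hN0, hNN, fun w hw => ?_⟩
  rw [hLC _ (hτ w hw), hLC w hw, fundSol_add_period, ← mul_assoc, ← mul_assoc, hN]

end Solution

section DiskAlgebra

open MeasureTheory AddCircle

/-! ### Continuous functions on the circle and the disk algebra -/

/-- Continuous functions on the unit circle. -/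
abbrev CircFun : Type := C(Circle, ℂ)

/-- The coordinate function `λ` on the circle. -/
def lam : CircFun := ⟨fun l => (l : ℂ), by fun_prop⟩

/-- The function `λ⁻¹` on the circle. -/
def lamInv : CircFun := ⟨fun l => (l : ℂ)⁻¹, Continuous.inv₀ (by fun_prop) fun l => l.coe_ne_zero⟩

@[simp] theorem lam_apply (l : Circle) : lam l = l := rfl

@[simp] theorem lamInv_apply (l : Circle) : lamInv l = (l : ℂ)⁻¹ := rfl

theorem lam_mul_lamInv : lam * lamInv = 1 := by
  ext l; simp

local instance : Fact (0 < 2 * Real.pi) := ⟨Real.two_pi_pos⟩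

theorem integrable_fourier_mul (n : ℤ) (f : CircFun) :
    Integrable (fun x : AddCircle (2 * Real.pi) => fourier (-n) x * f (toCircle x))
      haarAddCircle := by
  have : Continuous fun x : AddCircle (2 * Real.pi) => fourier (-n) x * f (toCircle x) :=
    (map_continuous (fourier (-n))).mul ((map_continuous f).comp continuous_toCircle)
  exact this.integrable_of_hasCompactSupport (HasCompactSupport.of_compactSpace _)

/-- The `n`-th Fourier coefficient of a continuous function on the circle. -/
def coef (n : ℤ) : CircFun →L[ℂ] ℂ :=
  LinearMap.mkContinuous
    { toFun := fun f => ∫ x : AddCircle (2 * Real.pi), fourier (-n) x * f (toCircle x)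
        ∂haarAddCircle
      map_add' := fun f g => by
        rw [← integral_add (integrable_fourier_mul n f) (integrable_fourier_mul n g)]
        simp [mul_add]
      map_smul' := fun a f => by
        rw [RingHom.id_apply, smul_eq_mul, ← integral_const_mul]
        simp [mul_left_comm] } 1
    fun f => by
      have := norm_integral_le_of_norm_le_const
        (μ := (haarAddCircle : Measure (AddCircle (2 * Real.pi))))
        (f := fun x => fourier (-n) x * f (toCircle x)) (C := ‖f‖)
        (Filter.Eventually.of_forall fun x => by
          rw [norm_mul, fourier_apply, Circle.norm_coe, one_mul]; exact f.norm_coe_le_norm _)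
      simpa using this

theorem coef_apply (n : ℤ) (f : CircFun) :
    coef n f = ∫ x : AddCircle (2 * Real.pi), fourier (-n) x * f (toCircle x) ∂haarAddCircle :=
  rfl

theorem coef_eq_fourierCoeff (n : ℤ) (f : CircFun) :
    coef n f = fourierCoeff (fun x : AddCircle (2 * Real.pi) => f (toCircle x)) n := rfl

theorem coef_lam_mul (n : ℤ) (f : CircFun) : coef n (lam * f) = coef (n - 1) f := by
  rw [coef_apply, coef_apply]
  congr 1; ext x
  have : (fourier (-(n - 1)) x : ℂ) = fourier (-n) x * toCircle x := by
    rw [show -(n - 1) = -n + 1 by ring, fourier_add, fourier_one]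
  rw [this, ContinuousMap.mul_apply, lam_apply, mul_assoc]

theorem coef_lam_pow_mul (n : ℤ) (k : ℕ) (f : CircFun) :
    coef n (lam ^ k * f) = coef (n - k) f := by
  induction k generalizing n with
  | zero => simp
  | succ k ih =>
    rw [pow_succ', mul_assoc, coef_lam_mul, ih]
    congr 2; push_cast; ring

theorem coef_one (n : ℤ) : coef n 1 = if n = 0 then 1 else 0 := by
  rw [coef_eq_fourierCoeff]
  have h := congrFun (fourierCoeff_fourier (T := 2 * Real.pi) 0) n
  have h' : (fun x : AddCircle (2 * Real.pi) => (1 : CircFun) (toCircle x)) =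
      fourier (T := 2 * Real.pi) 0 := by
    ext x; simp
  rw [h', h, Pi.single_apply]

theorem coef_lam_pow (n : ℤ) (k : ℕ) : coef n (lam ^ k) = if n = k then 1 else 0 := by
  have := coef_lam_pow_mul n k 1
  rw [mul_one, coef_one] at this
  rw [this]; simp [sub_eq_zero]

theorem circFun_eq_zero {f : CircFun} (h : ∀ n, coef n f = 0) : f = 0 := by
  set g : C(AddCircle (2 * Real.pi), ℂ) :=
    ⟨fun x => f (toCircle x), (map_continuous f).comp continuous_toCircle⟩
  have h0 : fourierCoeff g = 0 := funext fun n => h n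
  have h1 := hasSum_fourier_series_of_summable (f := g) (by rw [h0]; exact summable_zero)
  rw [h0] at h1
  simp only [Pi.zero_apply, zero_smul] at h1
  have h2 : g = 0 := h1.unique hasSum_zero
  ext l
  obtain ⟨x, rfl⟩ := (homeomorphCircle Real.two_pi_pos.ne').surjective l
  simpa [g, homeomorphCircle_apply] using DFunLike.congr_fun h2 x

theorem coef_star (n : ℤ) (f : CircFun) :
    coef n (star f) = (starRingEnd ℂ) (coef (-n) f) := by
  rw [coef_apply, coef_apply, ← integral_conj]
  congr 1; ext x
  simp only [map_mul, ContinuousMap.star_apply, RCLike.star_def]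
  rw [← fourier_neg, neg_neg]

theorem toCircle_pi : toCircle ((Real.pi : ℝ) : AddCircle (2 * Real.pi)) = Circle.exp Real.pi := by
  rw [toCircle_apply_mk]; congr 1; field_simp

theorem coef_neg_mul {f g : CircFun} (h : ∀ l, g l = f (Circle.exp Real.pi * l)) (n : ℤ) :
    coef n g = (-1) ^ n * coef n f := by
  have hpi : ((Circle.exp Real.pi ^ (-n) : Circle) : ℂ) = (-1) ^ n := by
    rw [Circle.coe_zpow, Circle.coe_exp, Complex.exp_pi_mul_I, _root_.zpow_neg, ← _root_.inv_zpow]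
    norm_num
  have hfourier (x : AddCircle (2 * Real.pi)) :
      (fourier (-n) ((Real.pi : AddCircle (2 * Real.pi)) + x) : ℂ) = (-1) ^ n * fourier (-n) x := by
    rw [fourier_apply, smul_add, toCircle_add, toCircle_zsmul _ (-n), toCircle_pi, Circle.coe_mul,
      hpi, fourier_apply]
  rw [coef_apply, coef_apply, ← integral_add_left_eq_self (μ := haarAddCircle)
    (fun x => fourier (-n) x * f (toCircle x)) (Real.pi : AddCircle (2 * Real.pi)),
    ← integral_const_mul]
  congr 1; ext x
  rw [toCircle_add, toCircle_pi, hfourier, h, ← mul_assoc, ← mul_assoc, ← mul_zpow, neg_one_mul,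
    neg_neg, _root_.one_zpow, one_mul]

/-- The disk algebra: the closed subalgebra of the continuous functions on the circle that is
generated by `λ`. -/
def diskAlg : Subalgebra ℂ CircFun := Algebra.elemental ℂ lam

theorem isClosed_diskAlg : IsClosed (diskAlg : Set CircFun) := Algebra.elemental.isClosed ℂ lam

theorem lam_mem_diskAlg : lam ∈ diskAlg := Algebra.elemental.self_mem ℂ lam

theorem diskAlg_le {K : Submodule ℂ CircFun} (hK : IsClosed (K : Set CircFun))
    (h : ∀ k : ℕ, lam ^ k ∈ K) {f : CircFun} (hf : f ∈ diskAlg) : f ∈ K := by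
  have h1 : (Algebra.adjoin ℂ {lam} : Set CircFun) ⊆ K := by
    intro g hg
    rw [Algebra.adjoin_singleton_eq_range_aeval] at hg
    obtain ⟨p, rfl⟩ := hg
    simp only [AlgHom.toRingHom_eq_coe, RingHom.coe_coe, Polynomial.aeval_eq_sum_range]
    exact Submodule.sum_mem _ fun k _ => K.smul_mem _ (h k)
  exact closure_minimal h1 hK hf

theorem coef_eq_zero_of_neg {f : CircFun} (hf : f ∈ diskAlg) {n : ℤ} (hn : n < 0) :
    coef n f = 0 := by
  refine diskAlg_le (K := (coef n).ker) (coef n).isClosed_ker (fun k => ?_) hf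
  rw [LinearMap.mem_ker, ContinuousLinearMap.coe_coe, coef_lam_pow, if_neg]
  omega

theorem coef_mul {f g : CircFun} (hf : f ∈ diskAlg) (hg : g ∈ diskAlg) (n : ℕ) :
    coef n (f * g) = ∑ p ∈ Finset.HasAntidiagonal.antidiagonal n, coef p.1 f * coef p.2 g := by
  set T : CircFun →L[ℂ] ℂ := (coef n).comp ((ContinuousLinearMap.mul ℂ CircFun).flip g) -
    ∑ p ∈ Finset.HasAntidiagonal.antidiagonal n, coef p.2 g • coef p.1 with hT
  have hT' : ∀ f, T f = coef n (f * g) -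
      ∑ p ∈ Finset.HasAntidiagonal.antidiagonal n, coef p.1 f * coef p.2 g := by
    intro f; simp [hT, mul_comm]
  have : f ∈ T.ker := by
    refine diskAlg_le (K := T.ker) T.isClosed_ker (fun k => ?_) hf
    rw [LinearMap.mem_ker, ContinuousLinearMap.coe_coe, hT', coef_lam_pow_mul, sub_eq_zero]
    by_cases hk : k ≤ n
    · rw [Finset.sum_eq_single (k, n - k)]
      · rw [coef_lam_pow, if_pos rfl, one_mul]
        push_cast [hk]; rfl
      · rintro ⟨i, j⟩ hij hne
        rw [Finset.HasAntidiagonal.mem_antidiagonal] at hij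
        rw [coef_lam_pow, if_neg, zero_mul]
        intro h
        apply hne
        have : i = k := by exact_mod_cast h
        simp only [Prod.mk.injEq]; simp only at hij; omega
      · intro h; exact absurd (Finset.HasAntidiagonal.mem_antidiagonal.2 (by simp; omega)) h
    · rw [coef_eq_zero_of_neg hg (by omega), Finset.sum_eq_zero]
      rintro ⟨i, j⟩ hij
      rw [Finset.HasAntidiagonal.mem_antidiagonal] at hij
      rw [coef_lam_pow, if_neg, zero_mul]
      simp only at hij ⊢; omega
  rw [LinearMap.mem_ker, ContinuousLinearMap.coe_coe, hT', sub_eq_zero] at this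
  exact this

theorem coef_zero_mul {f g : CircFun} (hf : f ∈ diskAlg) (hg : g ∈ diskAlg) :
    coef 0 (f * g) = coef 0 f * coef 0 g := by
  have := coef_mul hf hg 0
  simpa using this

theorem coef_add_mul {f g : CircFun} (hf : f ∈ diskAlg) (hg : g ∈ diskAlg) {m n : ℕ}
    (hm : ∀ k < m, coef k f = 0) (hn : ∀ k < n, coef k g = 0) :
    coef ((m + n : ℕ) : ℤ) (f * g) = coef m f * coef n g := by
  rw [coef_mul hf hg, Finset.sum_eq_single (m, n)]
  · rintro ⟨i, j⟩ hij hne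
    rw [Finset.HasAntidiagonal.mem_antidiagonal] at hij
    simp only at hij
    rcases lt_or_ge i m with h | h
    · rw [hm i h, zero_mul]
    · have : j < n := by
        by_contra hj
        apply hne
        simp only [Prod.mk.injEq]; omega
      rw [hn j this, mul_zero]
  · intro h
    exact absurd (Finset.HasAntidiagonal.mem_antidiagonal.2 (by simp)) h

theorem dilate_mem_diskAlg {f : CircFun} {E : ℂ → ℂ}
    (hE : DifferentiableOn ℂ E (Metric.ball 0 1)) {r : ℝ} (hr0 : 0 ≤ r) (hr1 : r < 1)
    (hf : ∀ l : Circle, f l = E (r * l)) : f ∈ diskAlg := by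
  obtain ⟨R, hrR, hR1⟩ := exists_between hr1
  obtain ⟨s, hrs, hsR⟩ := exists_between hrR
  lift R to NNReal using hr0.trans hrR.le
  lift s to NNReal using hr0.trans hrs.le
  have hps := DifferentiableOn.hasFPowerSeriesOnBall (c := 0) (R := R) (f := E)
    (hE.mono (Metric.closedBall_subset_ball hR1)) (by exact_mod_cast hr0.trans_lt hrR)
  have hun := hps.tendstoUniformlyOn (r' := s) (by exact_mod_cast hsR)
  set p := cauchyPowerSeries E 0 R
  have hsum : ∀ (n : ℕ) (l : Circle),
      p.partialSum n (r * l) =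
        (∑ k ∈ Finset.range n, (p.coeff k * (r : ℂ) ^ k) • lam ^ k : CircFun) l := by
    intro n l
    rw [FormalMultilinearSeries.partialSum, ContinuousMap.sum_apply]
    refine Finset.sum_congr rfl fun k _ => ?_
    rw [FormalMultilinearSeries.apply_eq_pow_smul_coeff]
    simp only [ContinuousMap.smul_apply, ContinuousMap.pow_apply, lam_apply, smul_eq_mul]
    ring
  have hlim : Filter.Tendsto
      (fun n => ∑ k ∈ Finset.range n, (p.coeff k * (r : ℂ) ^ k) • lam ^ k)
      Filter.atTop (nhds f) := by
    rw [ContinuousMap.tendsto_iff_tendstoUniformly, ← tendstoUniformlyOn_univ]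
    refine ((hun.comp fun l : Circle => (r * l : ℂ)).mono fun l _ => ?_).congr ?_ |>.congr_right ?_
    · rw [Set.mem_preimage, mem_ball_zero_iff, norm_mul, Circle.norm_coe, Complex.norm_real,
        Real.norm_of_nonneg hr0, mul_one]
      exact hrs
    · exact .of_forall fun n l _ => hsum n l
    · intro l _
      rw [Function.comp_apply, zero_add, hf]
  refine isClosed_diskAlg.mem_of_tendsto hlim (.of_forall fun n => ?_)
  exact Subalgebra.sum_mem _ fun k _ => Subalgebra.smul_mem _ (pow_mem lam_mem_diskAlg k) _

theorem mem_diskAlg_of_extension {f : CircFun} {E : ℂ → ℂ}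
    (hc : ContinuousOn E (Metric.closedBall 0 1)) (hd : DifferentiableOn ℂ E (Metric.ball 0 1))
    (hf : ∀ l : Circle, E l = f l) : f ∈ diskAlg := by
  have hmaps : ∀ p : unitInterval × Circle, (p.1 * p.2 : ℂ) ∈ Metric.closedBall (0 : ℂ) 1 := by
    intro p
    rw [mem_closedBall_zero_iff, norm_mul, Circle.norm_coe, Complex.norm_real,
      Real.norm_of_nonneg p.1.2.1, mul_one]
    exact p.1.2.2
  set g : C(unitInterval × Circle, ℂ) :=
    ⟨fun p => E (p.1 * p.2), hc.comp_continuous (by fun_prop) hmaps⟩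
  have hcl : IsClosed {r | g.curry r ∈ diskAlg} := isClosed_diskAlg.preimage g.curry.continuous
  have hlt : Set.Iio 1 ⊆ {r | g.curry r ∈ diskAlg} := fun r hr =>
    dilate_mem_diskAlg hd r.2.1 hr fun l => rfl
  have h1 : g.curry 1 ∈ diskAlg := by
    refine hcl.closure_subset_iff.2 hlt ?_
    rw [closure_Iio' ⟨0, zero_lt_one⟩]
    exact Set.mem_Iic.2 le_rfl
  convert h1
  ext l
  simp [g, hf]

end DiskAlgebra

/-! ### Loops as matrices of continuous functions -/

/-- Matrices of continuous functions on the unit circle. -/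
abbrev CircMat : Type := Matrix (Fin 2) (Fin 2) CircFun

/-- A scalar loop as a continuous function; it is `0` if the loop is not continuous. -/
def circFunOf (g : Circle → ℂ) : CircFun :=
  open scoped Classical in if h : Continuous g then ⟨g, h⟩ else 0

theorem circFunOf_apply {g : Circle → ℂ} (h : Continuous g) (l : Circle) :
    circFunOf g l = g l := by
  rw [circFunOf, dif_pos h, ContinuousMap.coe_mk]

/-- A matrix loop as a matrix of continuous functions; entries that are not continuous are replaced
by `0`. -/
def loopFun (g : Loop) : CircMat :=
  Matrix.of fun i j => circFunOf fun l => g l i j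

/-- Evaluation of continuous functions at a point of the circle. -/
def ev (l : Circle) : CircFun →+* ℂ := (ContinuousMap.evalAlgHom ℂ ℂ l).toRingHom

@[simp]
theorem ev_apply (l : Circle) (f : CircFun) : ev l f = f l := rfl

theorem map_loopFun {g : Loop} (h : Continuous g) (l : Circle) : (loopFun g).map (ev l) = g l := by
  ext i j
  exact circFunOf_apply (h.matrix_elem i j) l

theorem ext_map_ev {M N : CircMat}
    (h : ∀ l, M.map (ev l) = N.map (ev l)) : M = N := by
  ext i j l
  exact congrFun (congrFun (h l) i) j

theorem map_ev_mul (M N : CircMat) (l : Circle) :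
    (M * N).map (ev l) = M.map (ev l) * N.map (ev l) := Matrix.map_mul

theorem map_ev_sub (M N : CircMat) (l : Circle) :
    (M - N).map (ev l) = M.map (ev l) - N.map (ev l) := Matrix.map_sub _ (map_sub _) M N

theorem map_ev_smul (f : CircFun) (M : CircMat) (l : Circle) :
    (f • M).map (ev l) = f l • M.map (ev l) := Matrix.map_smul' (ev l) f M (map_mul _)

theorem map_ev_adjugate (M : CircMat) (l : Circle) :
    M.adjugate.map (ev l) = (M.map (ev l)).adjugate :=
  RingHom.map_adjugate (ev l) M

theorem trace_apply_circFun (M : CircMat) (l : Circle) :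
    M.trace l = (M.map (ev l)).trace := by
  simp [trace_fin_two]

theorem det_loopFun {g : Loop} (h : Continuous g) (hd : ∀ l, (g l).det = 1) :
    (loopFun g).det = 1 := by
  ext l
  have h1 := RingHom.map_det (ev l) (loopFun g)
  rw [RingHom.mapMatrix_apply, map_loopFun h, hd] at h1
  exact h1

/-- A constant matrix as a matrix of functions on the circle. -/
def constMat (M : Mat2) : CircMat := M.map (algebraMap ℂ CircFun)

theorem map_ev_constMat (M : Mat2) (l : Circle) : (constMat M).map (ev l) = M := by
  ext i j
  simp [constMat, algebraMap_apply]

theorem hasDerivAt_continuousMap {𝕜 K E : Type*} [RCLike 𝕜] [TopologicalSpace K] [CompactSpace K]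
    [NormedAddCommGroup E] [NormedSpace 𝕜 E] {g g' : 𝕜 → C(K, E)} {x : 𝕜}
    (hg : ∀ᶠ s in nhds x, ∀ l, HasDerivAt (fun s => g s l) (g' s l) s) (hg' : ContinuousAt g' x) :
    HasDerivAt g (g' x) x := by
  rw [hasDerivAt_iff_isLittleO, Asymptotics.isLittleO_iff]
  intro ε hε
  obtain ⟨δ, hδ, hball⟩ := Metric.mem_nhds_iff.1
    (hg.and (hg'.eventually (Metric.ball_mem_nhds (g' x) hε)))
  filter_upwards [Metric.ball_mem_nhds x hδ] with s hs
  rw [ContinuousMap.norm_le _ (by positivity)]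
  intro l
  have hderiv : ∀ y ∈ Metric.ball x δ,
      HasDerivWithinAt (fun s => g s l - (s - x) • g' x l) (g' y l - g' x l)
        (Metric.ball x δ) y := by
    intro y hy
    simpa only [one_smul] using (((hball hy).1 l).fun_sub
      (((hasDerivAt_id' y).sub_const x).smul_const (g' x l))).hasDerivWithinAt
  have hbound : ∀ y ∈ Metric.ball x δ, ‖g' y l - g' x l‖ ≤ ε := fun y hy => by
    rw [← dist_eq_norm]
    exact (ContinuousMap.dist_apply_le_dist l).trans (Metric.mem_ball.1 (hball hy).2).le
  have h := (convex_ball x δ).norm_image_sub_le_of_norm_hasDerivWithin_le hderiv hbound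
    (Metric.mem_ball_self hδ) hs
  rw [sub_self, zero_smul, sub_zero, sub_right_comm] at h
  exact h

theorem hasDerivAt_loopFun {𝕜 : Type*} [RCLike 𝕜] [NormedAlgebra 𝕜 ℂ] {g g' : 𝕜 → Loop} {x : 𝕜}
    {V : Set 𝕜} (hV : V ∈ nhds x) (hg : ∀ s ∈ V, ∀ l, HasDerivAt (fun s => g s l) (g' s l) s)
    (hc : ∀ s ∈ V, Continuous (g s))
    (hg' : ContinuousOn (fun p : 𝕜 × Circle => g' p.1 p.2) (V ×ˢ Set.univ)) :
    HasDerivAt (fun s => loopFun (g s)) (loopFun (g' x)) x := by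
  have hc' : ∀ s ∈ V, Continuous (g' s) := fun s hs =>
    hg'.comp_continuous (f := fun l => (s, l)) (by fun_prop) fun l => ⟨hs, trivial⟩
  rw [hasDerivAt_matrix]
  intro i j
  refine hasDerivAt_continuousMap (g' := fun s => loopFun (g' s) i j) ?_ ?_
  · filter_upwards [eventually_mem_nhds_iff.2 hV] with s hs l
    have hs' := mem_of_mem_nhds hs
    have h := hasDerivAt_matrix.1 (hg s hs' l) i j
    rw [← circFunOf_apply ((hc' s hs').matrix_elem i j) l] at h
    refine h.congr_of_eventuallyEq ?_
    filter_upwards [hs] with r hr using circFunOf_apply ((hc r hr).matrix_elem i j) l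
  · rw [ContinuousAt, ContinuousMap.tendsto_iff_tendstoUniformly]
    have hxV := mem_of_mem_nhds hV
    have h : TendstoUniformly (fun s l => g' s l i j) (fun l => g' x l i j) (nhds x) :=
      ContinuousOn.tendstoUniformly hV ((continuous_id.matrix_elem i j).comp_continuousOn hg')
    simp only [Metric.tendstoUniformly_iff] at h ⊢
    intro ε hε
    filter_upwards [h ε hε, hV] with s hs hsV l
    simpa only [loopFun, of_apply, circFunOf_apply ((hc' x hxV).matrix_elem i j),
      circFunOf_apply ((hc' s hsV).matrix_elem i j)] using hs l

/-! ### Smooth families of loops -/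

section LineDerivatives

variable {E : Type*} [NormedAddCommGroup E] [NormedSpace ℝ E] {x v : E}

theorem hasLineDerivAt_add {G : Type*} [NormedAddCommGroup G] [NormedSpace ℝ G] {f g : E → G}
    {f' g' : G} (hf : HasLineDerivAt ℝ f f' x v) (hg : HasLineDerivAt ℝ g g' x v) :
    HasLineDerivAt ℝ (fun y => f y + g y) (f' + g') x v :=
  HasDerivAt.add hf hg

theorem hasLineDerivAt_const_smul {G : Type*} [NormedAddCommGroup G] [NormedSpace ℝ G]
    [NormedSpace ℂ G] [SMulCommClass ℝ ℂ G] {f : E → G} {f' : G} (a : ℂ)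
    (hf : HasLineDerivAt ℝ f f' x v) :
    HasLineDerivAt ℝ (fun y => a • f y) (a • f') x v :=
  HasDerivAt.const_smul a hf

theorem hasLineDerivAt_mul {A : Type*} [NormedRing A] [NormedAlgebra ℝ A] {f g : E → A} {f' g' : A}
    (hf : HasLineDerivAt ℝ f f' x v) (hg : HasLineDerivAt ℝ g g' x v) :
    HasLineDerivAt ℝ (fun y => f y * g y) (f' * g x + f x * g') x v := by
  have h := HasDerivAt.mul hf hg
  simp only [zero_smul, add_zero] at h
  exact h

theorem hasLineDerivAt_comp_add_right {G : Type*} [NormedAddCommGroup G] [NormedSpace ℝ G]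
    {f : E → G} {f' : G} {a : E} (h : HasLineDerivAt ℝ f f' (x + a) v) :
    HasLineDerivAt ℝ (fun y => f (y + a)) f' x v := by
  simp only [HasLineDerivAt, add_right_comm x a] at h
  exact h

theorem differentiableAt_adjugate {g : E → Mat2} (hg : DifferentiableAt ℝ g x) :
    DifferentiableAt ℝ (fun y => (g y).adjugate) x := by
  let A : Mat2 →ₗ[ℝ] Mat2 :=
    { toFun := adjugate
      map_add' := adjugate_add_fin_two
      map_smul' := fun a M => by simp [adjugate_fin_two] }
  exact A.toContinuousLinearMap.differentiableAt.comp x hg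

theorem hasLineDerivAt_adjugate_of_det {R : Type*} [NormedCommRing R] [NormedAlgebra ℝ R]
    {g : E → Matrix (Fin 2) (Fin 2) R} {g' : Matrix (Fin 2) (Fin 2) R}
    (hg : HasLineDerivAt ℝ g g' x v) (hdet : ∀ᶠ y in nhds x, (g y).det = 1) :
    HasLineDerivAt ℝ (fun y => (g y).adjugate) (-((g x).adjugate * g' * (g x).adjugate)) x v := by
  have hline : Filter.Tendsto (fun t : ℝ => x + t • v) (nhds 0) (nhds x) :=
    Continuous.tendsto' (by fun_prop) _ _ (by simp)
  have h := hasDerivAt_adjugate_of_det hg (hline.eventually hdet)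
  simp only [zero_smul, add_zero] at h
  exact h

theorem hasLineDerivAt_lineDeriv {G : Type*} [NormedAddCommGroup G] [NormedSpace ℝ G] {f : E → G}
    (hf : ContDiffAt ℝ 2 f x) (a b : E) :
    HasLineDerivAt ℝ (fun y => lineDeriv ℝ f y b) (fderiv ℝ (fderiv ℝ f) x a b) x a := by
  have hD : DifferentiableAt ℝ (fderiv ℝ f) x :=
    (hf.fderiv_right (m := 1) (by norm_num)).differentiableAt one_ne_zero
  have h : HasFDerivAt (fun y => fderiv ℝ f y b) _ x :=
    (ContinuousLinearMap.apply ℝ G b).hasFDerivAt.comp x hD.hasFDerivAt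
  refine (h.hasLineDerivAt a).congr_of_eventuallyEq ?_
  filter_upwards [hf.eventually (by simp)] with y hy
  exact (hy.differentiableAt two_ne_zero).lineDeriv_eq_fderiv

theorem lineDeriv_lineDeriv_comm {G : Type*} [NormedAddCommGroup G] [NormedSpace ℝ G] {f : E → G}
    (hf : ContDiffAt ℝ 2 f x) (a b : E) :
    HasLineDerivAt ℝ (fun y => lineDeriv ℝ f y b)
      (lineDeriv ℝ (fun y => lineDeriv ℝ f y a) x b) x a := by
  rw [(hasLineDerivAt_lineDeriv hf b a).lineDeriv,
    (hf.isSymmSndFDerivAt (by simp)) b a]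
  exact hasLineDerivAt_lineDeriv hf a b

end LineDerivatives

section Families

/-- The derivative of a family of loops at `w` in the direction `v`. -/
def dirDeriv (F : ℂ → Loop) (v w : ℂ) : Loop := fun l => lineDeriv ℝ (fun w => F w l) w v

/-- The derivative `∂_t` of a loop, where `λ = exp (i t)`. -/
def angleDeriv (g : Loop) (l : Circle) : Mat2 := deriv (fun t : ℝ => g (Circle.exp t * l)) 0

theorem continuous_of_comp_exp {X : Type*} [TopologicalSpace X] {g : Circle → X}
    (h : Continuous fun t : ℝ => g (Circle.exp t)) : Continuous g := by
  refine continuous_iff_continuousAt.2 fun l => ?_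
  obtain ⟨t, rfl⟩ := Circle.exp_surjective l
  exact (Filter.tendsto_map' h.continuousAt).mono_left
    (isLocalHomeomorph_circleExp.isOpenMap.nhds_le t)

theorem continuousOn_of_comp_exp {X : Type*} [TopologicalSpace X] {U : Set ℂ} (hU : IsOpen U)
    {f : ℂ → Circle → X}
    (h : ContinuousOn (fun p : ℂ × ℝ => f p.1 (Circle.exp p.2)) (U ×ˢ Set.univ)) :
    ContinuousOn (fun p : ℂ × Circle => f p.1 p.2) (U ×ˢ Set.univ) := by
  rintro ⟨w, l⟩ ⟨hw, -⟩
  obtain ⟨t, rfl⟩ := Circle.exp_surjective l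
  have hopen : IsOpenMap (Prod.map id Circle.exp : ℂ × ℝ → ℂ × Circle) :=
    IsOpenMap.id.prodMap isLocalHomeomorph_circleExp.isOpenMap
  have hat := h.continuousAt ((hU.prod isOpen_univ).mem_nhds (x := (w, t)) ⟨hw, trivial⟩)
  have hmap : Filter.Tendsto (fun p : ℂ × Circle => f p.1 p.2)
      (Filter.map (Prod.map id Circle.exp) (nhds (w, t))) (nhds (f w (Circle.exp t))) :=
    Filter.tendsto_map' hat
  exact ContinuousAt.continuousWithinAt (hmap.mono_left (hopen.nhds_le (w, t)))

theorem IsSmoothLoop.continuous {g : Loop} (h : IsSmoothLoop g) : Continuous g :=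
  continuous_of_comp_exp (continuous_matrix fun i j => (h i j).continuous)

variable {U : Set ℂ} {F : ℂ → Loop} {w : ℂ}

theorem IsSmoothFamily.contDiffOn (hF : IsSmoothFamily U F) :
    ContDiffOn ℝ ∞ (fun p : ℂ × ℝ => F p.1 (Circle.exp p.2)) (U ×ˢ Set.univ) := by
  have h (p : ℂ × ℝ) : F p.1 (Circle.exp p.2) =
      ∑ i, ∑ j, F p.1 (Circle.exp p.2) i j • single i j (1 : ℂ) := by
    conv_lhs => rw [matrix_eq_sum_single (F p.1 (Circle.exp p.2))]
    simp only [smul_single, smul_eq_mul, mul_one]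
  refine ContDiffOn.congr ?_ fun p _ => h p
  exact ContDiffOn.sum fun i _ => ContDiffOn.sum fun j _ => (hF i j).smul contDiffOn_const

theorem IsSmoothFamily.contDiffAt (hU : IsOpen U) (hF : IsSmoothFamily U F) (hw : w ∈ U) (t : ℝ) :
    ContDiffAt ℝ ∞ (fun p : ℂ × ℝ => F p.1 (Circle.exp p.2)) (w, t) :=
  hF.contDiffOn.contDiffAt ((hU.prod isOpen_univ).mem_nhds ⟨hw, trivial⟩)

theorem IsSmoothFamily.differentiableAt (hU : IsOpen U) (hF : IsSmoothFamily U F) (hw : w ∈ U)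
    (l : Circle) : DifferentiableAt ℝ (fun w => F w l) w := by
  obtain ⟨t, rfl⟩ := Circle.exp_surjective l
  exact ((hF.contDiffAt hU hw t).differentiableAt (by simp)).comp w
    (f := fun w : ℂ => (w, t)) (by fun_prop)

theorem IsSmoothFamily.hasLineDerivAt (hU : IsOpen U) (hF : IsSmoothFamily U F) (hw : w ∈ U)
    (v : ℂ) (l : Circle) : HasLineDerivAt ℝ (fun w => F w l) (dirDeriv F v w l) w v :=
  (hF.differentiableAt hU hw l).lineDifferentiableAt.hasLineDerivAt

theorem dirDeriv_exp (F : ℂ → Loop) (v w : ℂ) (t : ℝ) :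
    dirDeriv F v w (Circle.exp t) =
      lineDeriv ℝ (fun p : ℂ × ℝ => F p.1 (Circle.exp p.2)) (w, t) (v, 0) := by
  simp [dirDeriv, lineDeriv]

theorem angleDeriv_exp (F : ℂ → Loop) (w : ℂ) (t : ℝ) :
    angleDeriv (F w) (Circle.exp t) =
      lineDeriv ℝ (fun p : ℂ × ℝ => F p.1 (Circle.exp p.2)) (w, t) (0, 1) := by
  simp only [angleDeriv, lineDeriv, ← Circle.exp_add, Prod.mk_add_mk, Prod.smul_mk, smul_zero,
    add_zero, smul_eq_mul, mul_one, add_comm t]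
  rfl

theorem IsSmoothFamily.hasDerivAt_angle (hU : IsOpen U) (hF : IsSmoothFamily U F) (hw : w ∈ U)
    (l : Circle) :
    HasDerivAt (fun t : ℝ => F w (Circle.exp t * l)) (angleDeriv (F w) l) 0 := by
  obtain ⟨s, rfl⟩ := Circle.exp_surjective l
  have h := (hF.contDiffAt hU hw (0 + s)).differentiableAt (by simp)
  have hd : DifferentiableAt ℝ (fun t : ℝ => F w (Circle.exp (t + s))) 0 :=
    h.comp 0 (f := fun t : ℝ => (w, t + s)) (by fun_prop)
  simp only [Circle.exp_add] at hd
  exact hd.hasDerivAt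

theorem lambdaDeriv_eq {g : Loop} {l : Circle}
    (hg : DifferentiableAt ℝ (fun t : ℝ => g (Circle.exp t * l)) 0) :
    lambdaDeriv g l = -Complex.I • angleDeriv g l := by
  ext i j
  rw [lambdaDeriv, of_apply, (hasDerivAt_matrix.1 hg.hasDerivAt i j).deriv]
  rfl

theorem IsSmoothFamily.continuousOn (hU : IsOpen U) (hF : IsSmoothFamily U F) :
    ContinuousOn (fun p : ℂ × Circle => F p.1 p.2) (U ×ˢ Set.univ) :=
  continuousOn_of_comp_exp hU hF.contDiffOn.continuousOn

theorem IsSmoothFamily.continuous (hU : IsOpen U) (hF : IsSmoothFamily U F) (hw : w ∈ U) :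
    Continuous (F w) :=
  (hF.continuousOn hU).comp_continuous (f := fun l => (w, l)) (by fun_prop) fun _ => ⟨hw, trivial⟩

theorem IsSmoothFamily.continuousOn_dirDeriv (hU : IsOpen U) (hF : IsSmoothFamily U F) (v : ℂ) :
    ContinuousOn (fun p : ℂ × Circle => dirDeriv F v p.1 p.2) (U ×ˢ Set.univ) := by
  have hopen : IsOpen (U ×ˢ (Set.univ : Set ℝ)) := hU.prod isOpen_univ
  refine continuousOn_of_comp_exp hU ?_
  refine ((hF.contDiffOn.continuousOn_fderiv_of_isOpen hopen (by simp)).clm_apply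
    (continuousOn_const (c := ((v, 0) : ℂ × ℝ)))).congr fun p hp => ?_
  rw [dirDeriv_exp]
  exact ((hF.contDiffAt hU hp.1 p.2).differentiableAt (by simp)).lineDeriv_eq_fderiv

theorem IsSmoothFamily.continuous_dirDeriv (hU : IsOpen U) (hF : IsSmoothFamily U F) (hw : w ∈ U)
    (v : ℂ) : Continuous (dirDeriv F v w) :=
  (hF.continuousOn_dirDeriv hU v).comp_continuous (f := fun l => (w, l)) (by fun_prop)
    fun _ => ⟨hw, trivial⟩

theorem IsSmoothFamily.hasLineDerivAt_loopFun (hU : IsOpen U) (hF : IsSmoothFamily U F)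
    (hw : w ∈ U) (v : ℂ) :
    HasLineDerivAt ℝ (fun w => loopFun (F w)) (loopFun (dirDeriv F v w)) w v := by
  have hV : {s : ℝ | w + s • v ∈ U} ∈ nhds (0 : ℝ) :=
    (hU.preimage (by fun_prop)).mem_nhds (by simpa using hw)
  have h := hasDerivAt_loopFun (𝕜 := ℝ) (g := fun s => F (w + s • v))
    (g' := fun s => dirDeriv F v (w + s • v)) hV (fun s hs l => ?_)
    (fun s hs => hF.continuous hU hs)
    ((hF.continuousOn_dirDeriv hU v).comp (f := fun p : ℝ × Circle => (w + p.1 • v, p.2))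
      (by fun_prop) fun p hp => ⟨hp.1, trivial⟩)
  · simp only [zero_smul, add_zero] at h
    exact h
  · have hline : HasDerivAt (fun s : ℝ => w + s • v) v s := by
      simpa using ((hasDerivAt_id s).smul_const v).const_add w
    have hd := hF.differentiableAt hU hs l
    refine (hd.hasFDerivAt.comp_hasDerivAt s hline).congr_deriv ?_
    exact hd.lineDeriv_eq_fderiv.symm

theorem IsSmoothFamily.hasLineDerivAt_angleDeriv (hU : IsOpen U) (hF : IsSmoothFamily U F)
    (hw : w ∈ U) (v : ℂ) (l : Circle) :
    HasLineDerivAt ℝ (fun w => angleDeriv (F w) l) (angleDeriv (dirDeriv F v w) l) w v := by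
  obtain ⟨t, rfl⟩ := Circle.exp_surjective l
  have h := lineDeriv_lineDeriv_comm ((hF.contDiffAt hU hw t).of_le (by norm_cast)) (v, 0) (0, 1)
  have hangle (s : ℝ) : angleDeriv (F (w + s • v)) (Circle.exp t) =
      lineDeriv ℝ (fun p : ℂ × ℝ => F p.1 (Circle.exp p.2)) ((w, t) + s • (v, 0)) (0, 1) := by
    rw [angleDeriv_exp]
    simp
  have hdir : angleDeriv (dirDeriv F v w) (Circle.exp t) =
      lineDeriv ℝ (fun q : ℂ × ℝ =>
        lineDeriv ℝ (fun p : ℂ × ℝ => F p.1 (Circle.exp p.2)) q (v, 0)) (w, t) (0, 1) := by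
    simp only [angleDeriv, ← Circle.exp_add, dirDeriv_exp]
    simp only [lineDeriv, Prod.mk_add_mk, Prod.smul_mk, smul_zero, add_zero, smul_eq_mul, mul_one,
      add_comm t]
    rfl
  rw [hdir]
  exact HasDerivAt.congr_of_eventuallyEq h (.of_forall hangle)

end Families

/-! ### Matrices over the disk algebra -/

section DiskMatrices

variable {M N : CircMat}

/-- The subalgebra of matrices with entries in the disk algebra. -/
abbrev diskMat : Subalgebra ℂ CircMat := diskAlg.matrix

theorem lam_smul_mem_diskMat (hM : M ∈ diskMat) : lam • M ∈ diskMat :=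
  fun i j => diskAlg.mul_mem lam_mem_diskAlg (hM i j)

theorem constMat_mem_diskMat (A : Mat2) : constMat A ∈ diskMat :=
  fun i j => diskAlg.algebraMap_mem (A i j)

theorem adjugate_mem_diskMat (hM : M ∈ diskMat) : M.adjugate ∈ diskMat := by
  intro i j
  rw [adjugate_fin_two]
  fin_cases i <;> fin_cases j
  · exact hM 1 1
  · exact diskAlg.neg_mem (hM 0 1)
  · exact diskAlg.neg_mem (hM 1 0)
  · exact hM 0 0

theorem hasDerivAt_mem_of_isClosed {𝕜 E : Type*} [NontriviallyNormedField 𝕜] [NormedAddCommGroup E]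
    [NormedSpace 𝕜 E] {K : Submodule 𝕜 E} (hK : IsClosed (K : Set E)) {g : 𝕜 → E} {g' : E} {x : 𝕜}
    (hg : HasDerivAt g g' x) (h : ∀ᶠ y in nhds x, g y ∈ K) : g' ∈ K := by
  refine hK.mem_of_tendsto (hasDerivAt_iff_tendsto_slope.1 hg) ?_
  filter_upwards [h.filter_mono nhdsWithin_le_nhds] with y hy
  exact K.smul_mem _ (K.sub_mem hy h.self_of_nhds)

theorem hasLineDerivAt_mem_diskMat {g : ℂ → CircMat} {g' : CircMat} {w v : ℂ}
    (hg : HasLineDerivAt ℝ g g' w v) (h : ∀ᶠ y in nhds w, g y ∈ diskMat) : g' ∈ diskMat := by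
  have hline : Filter.Tendsto (fun t : ℝ => w + t • v) (nhds 0) (nhds w) :=
    Continuous.tendsto' (by fun_prop) _ _ (by simp)
  have hd := hasDerivAt_matrix.1 hg
  exact fun i j => hasDerivAt_mem_of_isClosed (𝕜 := ℝ)
    (K := (Subalgebra.toSubmodule diskAlg).restrictScalars ℝ) isClosed_diskAlg (hd i j)
    ((hline.eventually h).mono fun _ ht => ht i j)

/-- The matrix of the `n`-th Fourier coefficients. -/
def coefMat (n : ℤ) (M : CircMat) : Mat2 := M.map (coef n)

theorem coefMat_sub (n : ℤ) (M N : CircMat) : coefMat n (M - N) = coefMat n M - coefMat n N :=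
  Matrix.map_sub _ (map_sub _) M N

theorem coefMat_smul (n : ℤ) (a : ℂ) (M : CircMat) : coefMat n (a • M) = a • coefMat n M :=
  Matrix.map_smul _ a (map_smul _ a) M

theorem coefMat_lam_smul (n : ℤ) (M : CircMat) : coefMat n (lam • M) = coefMat (n - 1) M := by
  ext i j
  exact coef_lam_mul n (M i j)

theorem coefMat_lamInv_smul (n : ℤ) (M : CircMat) :
    coefMat n (lamInv • M) = coefMat (n + 1) M := by
  have h := coefMat_lam_smul (n + 1) (lamInv • M)
  rw [smul_smul, lam_mul_lamInv, one_smul, add_sub_cancel_right] at h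
  exact h.symm

theorem coefMat_one : coefMat 0 (1 : CircMat) = 1 := by
  ext i j
  simp only [coefMat, map_apply, one_apply]
  split_ifs <;> simp [coef_one]

theorem coefMat_adjugate (n : ℤ) (M : CircMat) : coefMat n M.adjugate = (coefMat n M).adjugate := by
  rw [adjugate_fin_two, adjugate_fin_two]
  ext i j
  fin_cases i <;> fin_cases j <;> simp [coefMat]

theorem coefMat_mul_constMat (n : ℤ) (M : CircMat) (A : Mat2) :
    coefMat n (M * constMat A) = coefMat n M * A := by
  ext i j
  simp [coefMat, mul_apply, constMat, Algebra.algebraMap_eq_smul_one, mul_comm]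

theorem coefMat_constMat_mul (n : ℤ) (A : Mat2) (M : CircMat) :
    coefMat n (constMat A * M) = A * coefMat n M := by
  ext i j
  simp [coefMat, mul_apply, constMat, Algebra.algebraMap_eq_smul_one]

theorem coefMat_reality (n : ℤ) (T : SurfaceClass) (M : CircMat) :
    coefMat n (reality T M) = reality T (coefMat (-n) M) :=
  map_reality T M (g := (coef n).toLinearMap.toAddMonoidHom) (coef_star n)

theorem map_ev_reality (T : SurfaceClass) (M : CircMat) (l : Circle) :
    (reality T M).map (ev l) = reality T (M.map (ev l)) :=
  map_reality T M (g := (ev l).toAddMonoidHom) fun _ => rfl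

theorem coefMat_eq_zero_of_neg (hM : M ∈ diskMat) {n : ℤ} (hn : n < 0) : coefMat n M = 0 := by
  ext i j
  exact coef_eq_zero_of_neg (hM i j) hn

theorem eq_zero_of_coefMat_eq_zero (h : ∀ n, coefMat n M = 0) : M = 0 := by
  refine Matrix.ext fun i j => ?_
  exact circFun_eq_zero fun n => congrFun (congrFun (h n) i) j

theorem coefMat_zero_mul (hM : M ∈ diskMat) (hN : N ∈ diskMat) :
    coefMat 0 (M * N) = coefMat 0 M * coefMat 0 N := by
  ext i j
  simp [coefMat, mul_apply, coef_zero_mul (hM _ _) (hN _ _)]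

theorem coefMat_add_mul (hM : M ∈ diskMat) (hN : N ∈ diskMat) {m n : ℕ}
    (hm : ∀ k < m, coefMat k M = 0) (hn : ∀ k < n, coefMat k N = 0) :
    coefMat ((m + n : ℕ) : ℤ) (M * N) = coefMat m M * coefMat n N := by
  have hm' (i j : Fin 2) : ∀ k < m, coef k (M i j) = 0 :=
    fun k hk => congrFun (congrFun (hm k hk) i) j
  have hn' (i j : Fin 2) : ∀ k < n, coef k (N i j) = 0 :=
    fun k hk => congrFun (congrFun (hn k hk) i) j
  ext i j
  simp only [coefMat, map_apply, mul_apply, map_sum,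
    coef_add_mul (hM _ _) (hN _ _) (hm' _ _) (hn' _ _)]

theorem det_coefMat_zero (hM : M ∈ diskMat) (hdet : M.det = 1) : (coefMat 0 M).det = 1 := by
  have h : coefMat 0 M * (coefMat 0 M).adjugate = 1 := by
    rw [← coefMat_adjugate, ← coefMat_zero_mul hM (adjugate_mem_diskMat hM),
      mul_adjugate_of_det hdet, coefMat_one]
  rw [mul_adjugate] at h
  simpa using congrFun (congrFun h 0) 0

theorem eq_laurent_of_coefMat (h : ∀ n : ℤ, 1 < |n| → coefMat n M = 0) :
    M = lamInv • constMat (coefMat (-1) M) + constMat (coefMat 0 M) +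
      lam • constMat (coefMat 1 M) := by
  have hconst (A : Mat2) (n : ℤ) : coefMat n (constMat A) = if n = 0 then A else 0 := by
    ext i j
    split_ifs <;> simp [coefMat, constMat, Algebra.algebraMap_eq_smul_one, coef_one, *]
  rw [← sub_eq_zero]
  refine eq_zero_of_coefMat_eq_zero fun n => ?_
  have hadd (M N : CircMat) : coefMat n (M + N) = coefMat n M + coefMat n N :=
    Matrix.map_add _ (map_add _) M N
  rw [coefMat_sub, hadd, hadd, coefMat_lamInv_smul, coefMat_lam_smul, hconst, hconst, hconst]
  rcases eq_or_ne n (-1) with rfl | h1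
  · simp
  rcases eq_or_ne n 0 with rfl | h2
  · simp
  rcases eq_or_ne n 1 with rfl | h3
  · simp
  rw [h n (by rw [lt_abs]; omega), if_neg (by omega), if_neg h2, if_neg (by omega)]
  simp

/-- The conjugate symmetry reflects the condition of having at most a simple pole at `λ = 0` to
`λ = ∞`. -/
theorem eq_laurent_of_reality {T : SurfaceClass} (hM : lam • M ∈ diskMat) (hr : reality T M = M) :
    M = lamInv • constMat (coefMat (-1) M) + constMat (coefMat 0 M) +
      lam • constMat (reality T (coefMat (-1) M)) := by
  have hneg (n : ℤ) (hn : n < -1) : coefMat n M = 0 := by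
    rw [show n = n + 1 - 1 by ring, ← coefMat_lam_smul]
    exact coefMat_eq_zero_of_neg hM (by omega)
  have href (n : ℤ) : coefMat n M = reality T (coefMat (-n) M) := by
    rw [← coefMat_reality, hr]
  rw [← href 1]
  refine eq_laurent_of_coefMat fun n hn => ?_
  rcases lt_abs.1 hn with h | h
  · rw [href, hneg (-n) (by omega)]
    cases T <;> ext i j <;> fin_cases i <;> fin_cases j <;> simp [reality]
  · exact hneg n (by omega)

end DiskMatrices

/-! ### Twisted loops -/

section Twisted

theorem sigma3_mul_mul_sigma3 (A : Mat2) :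
    sigma3 * A * sigma3 = !![A 0 0, -A 0 1; -A 1 0, A 1 1] := by
  rw [eta_fin_two A]
  simp [sigma3]

theorem isTwisted_iff {g : Loop} :
    IsTwisted g ↔ ∀ l, g (Circle.exp Real.pi * l) = sigma3 * g l * sigma3 := by
  refine forall_congr' fun l => ⟨fun ⟨h1, h2, h3, h4⟩ => ?_, fun h => ?_⟩
  · rw [sigma3_mul_mul_sigma3, eta_fin_two (g (Circle.exp Real.pi * l)), h1, h2, h3, h4]
  · rw [h, sigma3_mul_mul_sigma3]
    simp

theorem IsTwisted.mul {g k : Loop} (hg : IsTwisted g) (hk : IsTwisted k) :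
    IsTwisted fun l => g l * k l := by
  rw [isTwisted_iff] at *
  intro l
  rw [hg, hk]
  simp only [mul_assoc]
  rw [← mul_assoc sigma3 sigma3, sigma3_mul_sigma3, one_mul]

theorem IsTwisted.adjugate {g : Loop} (hg : IsTwisted g) : IsTwisted fun l => (g l).adjugate := by
  intro l
  obtain ⟨h1, h2, h3, h4⟩ := hg l
  simp [adjugate_fin_two, h1, h2, h3, h4]

theorem sigma3_mul_coefMat_mul_sigma3 {M : CircMat} (hM : IsTwisted fun l => M.map (ev l)) (n : ℤ) :
    sigma3 * coefMat n M * sigma3 = ((-1) ^ n : ℂ) • coefMat n M := by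
  have heven {f : CircFun} (h : ∀ l, f (Circle.exp Real.pi * l) = f l) :
      coef n f = (-1) ^ n * coef n f := coef_neg_mul (fun l => (h l).symm) n
  have hodd {f : CircFun} (h : ∀ l, f (Circle.exp Real.pi * l) = -f l) :
      -coef n f = (-1) ^ n * coef n f := by
    rw [← map_neg]
    exact coef_neg_mul (fun l => (h l).symm) n
  rw [sigma3_mul_mul_sigma3]
  ext i j
  fin_cases i <;> fin_cases j
  · exact heven fun l => (hM l).1
  · exact hodd fun l => (hM l).2.2.1
  · exact hodd fun l => (hM l).2.2.2
  · exact heven fun l => (hM l).2.1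

theorem commute_sigma3_coefMat_zero {M : CircMat} (hM : IsTwisted fun l => M.map (ev l)) :
    Commute sigma3 (coefMat 0 M) := by
  have h := sigma3_mul_coefMat_mul_sigma3 hM 0
  rw [zpow_zero, one_smul] at h
  rw [Commute, SemiconjBy]
  nth_rw 2 [← h]
  rw [mul_assoc, mul_assoc, sigma3_mul_sigma3, mul_one]

end Twisted

/-! ### Iwasawa splittings and the Maurer–Cartan form -/

theorem hasLineDerivAt_of_hasDerivAt {E : Type*} [NormedAddCommGroup E] [NormedSpace ℝ E]
    [NormedSpace ℂ E] [IsScalarTower ℝ ℂ E] {f : ℂ → E} {f' : E} {w : ℂ} (h : HasDerivAt f f' w)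
    (v : ℂ) : HasLineDerivAt ℝ f (v • f') w v :=
  (h.hasFDerivAt.restrictScalars ℝ).hasLineDerivAt v

/-- An Iwasawa splitting `L = F B` in the first cell over a connected open set `U` of values of
`w = log z`, with `L` a solution of the linear system. Compared with `IsSolution` and `IsFrame` the
conditions on `L` are weakened to those that follow from the conditions on `F` and `B`, and the
reality condition is stated by means of the involution `reality T`. -/
structure IsSplitting (T : SurfaceClass) (c : ℂ) (U : Set ℂ) (L F B : ℂ → Loop) : Prop where
  isOpen : IsOpen U
  isPreconnected : IsPreconnected U
  c_ne_zero : c ≠ 0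
  hasDerivAt : ∀ w ∈ U, ∀ l : Circle,
    HasDerivAt (fun v => L v l) (L w l * ((l : ℂ)⁻¹ • xiMat c w)) w
  smooth : IsSmoothFamily U F
  twisted : ∀ w ∈ U, IsTwisted (F w)
  det_F : ∀ w ∈ U, ∀ l, (F w l).det = 1
  reality_F : ∀ w ∈ U, ∀ l, reality T (F w l) = F w l
  pos : ∀ w ∈ U, B w ∈ loopPlus
  eq_mul : ∀ w ∈ U, ∀ l, L w l = F w l * B w l

/-- The Maurer–Cartan form `F⁻¹ dF` at `w`, evaluated on the direction `v`. -/
def maurerCartan (F : ℂ → Loop) (v w : ℂ) : CircMat :=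
  (loopFun (F w)).adjugate * loopFun (dirDeriv F v w)

/-- The coefficient of `λ⁻¹ dw` in the Maurer–Cartan form of the frame. -/
def polarPart (c : ℂ) (B : ℂ → Loop) (w : ℂ) : Mat2 :=
  coefMat 0 (loopFun (B w)) * xiMat c w * (coefMat 0 (loopFun (B w))).adjugate

theorem loopFun_mem_diskMat {g : Loop} (hg : g ∈ loopPlus) : loopFun g ∈ diskMat := by
  obtain ⟨⟨hs, -, -⟩, E, hE, hd, -, hEg⟩ := hg
  intro i j
  refine mem_diskAlg_of_extension (hE i j).continuousOn (hd i j) fun l => ?_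
  rw [hEg]
  exact (circFunOf_apply (hs.continuous.matrix_elem i j) l).symm

namespace IsSplitting

variable {T : SurfaceClass} {c : ℂ} {U : Set ℂ} {L F B : ℂ → Loop} (D : IsSplitting T c U L F B)
  {w : ℂ} (hw : w ∈ U)

include D hw

theorem continuous_F : Continuous (F w) := D.smooth.continuous D.isOpen hw

theorem continuous_B : Continuous (B w) := (D.pos w hw).1.1.continuous

theorem det_B (l : Circle) : (B w l).det = 1 := (D.pos w hw).1.2.2 l

theorem det_L (l : Circle) : (L w l).det = 1 := by
  rw [D.eq_mul w hw, det_mul, D.det_F w hw, D.det_B hw, one_mul]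

theorem continuous_L : Continuous (L w) := by
  rw [show L w = fun l => F w l * B w l from funext (D.eq_mul w hw)]
  exact (D.continuous_F hw).mul (D.continuous_B hw)

theorem loopFun_B_mem : loopFun (B w) ∈ diskMat := loopFun_mem_diskMat (D.pos w hw)

theorem det_loopFun_F : (loopFun (F w)).det = 1 := det_loopFun (D.continuous_F hw) (D.det_F w hw)

theorem loopFun_B_eq : loopFun (B w) = (loopFun (F w)).adjugate * loopFun (L w) := by
  refine ext_map_ev fun l => ?_
  rw [map_ev_mul, map_ev_adjugate, map_loopFun (D.continuous_F hw), map_loopFun (D.continuous_L hw),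
    map_loopFun (D.continuous_B hw), D.eq_mul w hw, ← mul_assoc,
    adjugate_mul_of_det (D.det_F w hw l), one_mul]

omit hw in
theorem continuousOn_L : ContinuousOn (fun p : ℂ × Circle => L p.1 p.2) (U ×ˢ Set.univ) := by
  rcases U.eq_empty_or_nonempty with rfl | ⟨w₀, hw₀⟩
  · simp
  have hL (p : ℂ × Circle) (hp : p ∈ U ×ˢ Set.univ) : L p.1 p.2 =
      (c / p.2 : ℂ) • (L w₀ p.2 * (fundSol c p.2 w₀).adjugate) * fundSol c p.2 p.1 :=
    solution_eq_mul_fundSol D.c_ne_zero D.isOpen D.isPreconnected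
      (fun w hw => D.hasDerivAt w hw p.2) hp.1 hw₀
  have h₀ : Continuous fun l : Circle => fundSol c l w₀ :=
    (continuous_fundSol c).comp (f := fun l : Circle => (w₀, l)) (by fun_prop)
  have hC : Continuous fun l : Circle => (c / l : ℂ) • (L w₀ l * (fundSol c l w₀).adjugate) :=
    (Continuous.div continuous_const (by fun_prop) fun l => l.coe_ne_zero).smul
      ((D.continuous_L hw₀).mul h₀.matrix_adjugate)
  exact ((hC.comp continuous_snd).mul (continuous_fundSol c)).continuousOn.congr hL

theorem hasDerivAt_loopFun_L :
    HasDerivAt (fun w => loopFun (L w))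
      (loopFun (L w) * (lamInv • constMat (xiMat c w))) w := by
  have hcont : ContinuousOn (fun p : ℂ × Circle => L p.1 p.2 * ((p.2 : ℂ)⁻¹ • xiMat c p.1))
      (U ×ˢ Set.univ) := by
    refine D.continuousOn_L.mul (Continuous.continuousOn ?_)
    refine (Continuous.inv₀ (by fun_prop) fun p : ℂ × Circle => p.2.coe_ne_zero).smul
      (continuous_matrix fun i j => ?_)
    fin_cases i <;> fin_cases j <;> simp only [xiMat, Fin.zero_eta, Fin.mk_one, of_apply,
      cons_val', cons_val_zero, cons_val_one, cons_val_fin_one] <;> fun_prop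
  have h := hasDerivAt_loopFun (𝕜 := ℂ) (g := L)
    (g' := fun w l => L w l * ((l : ℂ)⁻¹ • xiMat c w)) (D.isOpen.mem_nhds hw)
    D.hasDerivAt (fun _ hs => D.continuous_L hs) hcont
  have hc : Continuous fun l : Circle => L w l * ((l : ℂ)⁻¹ • xiMat c w) :=
    hcont.comp_continuous (f := fun l => (w, l)) (by fun_prop) fun _ => ⟨hw, trivial⟩
  refine h.congr_deriv (ext_map_ev fun l => (map_loopFun hc l).trans ?_)
  rw [map_ev_mul, map_ev_smul, map_ev_constMat, map_loopFun (D.continuous_L hw), lamInv_apply]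

theorem map_ev_maurerCartan (v : ℂ) (l : Circle) :
    (maurerCartan F v w).map (ev l) = (F w l).adjugate * dirDeriv F v w l := by
  rw [maurerCartan, map_ev_mul, map_ev_adjugate, map_loopFun (D.continuous_F hw),
    map_loopFun (D.smooth.continuous_dirDeriv D.isOpen hw v)]

theorem dirDeriv_eq_mul (v : ℂ) (l : Circle) :
    dirDeriv F v w l = F w l * (maurerCartan F v w).map (ev l) := by
  rw [D.map_ev_maurerCartan hw, ← mul_assoc, mul_adjugate_of_det (D.det_F w hw l), one_mul]

theorem hasLineDerivAt_loopFun_B (v : ℂ) :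
    HasLineDerivAt ℝ (fun w => loopFun (B w))
      (v • (loopFun (B w) * (lamInv • constMat (xiMat c w))) -
        maurerCartan F v w * loopFun (B w)) w v := by
  have hU := D.isOpen.mem_nhds hw
  have hF := hasLineDerivAt_adjugate_of_det (D.smooth.hasLineDerivAt_loopFun D.isOpen hw v)
    (Filter.mem_of_superset hU fun _ hy => D.det_loopFun_F hy)
  have h := hasLineDerivAt_mul hF (hasLineDerivAt_of_hasDerivAt (D.hasDerivAt_loopFun_L hw) v)
  have hval : v • (loopFun (B w) * (lamInv • constMat (xiMat c w))) -
      maurerCartan F v w * loopFun (B w) =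
      -((loopFun (F w)).adjugate * loopFun (dirDeriv F v w) * (loopFun (F w)).adjugate) *
        loopFun (L w) +
      (loopFun (F w)).adjugate * v • (loopFun (L w) * (lamInv • constMat (xiMat c w))) := by
    rw [D.loopFun_B_eq hw, maurerCartan]
    simp only [mul_assoc, mul_smul_comm, neg_mul]
    abel
  rw [hval]
  exact h.congr_of_eventuallyEq (Filter.mem_of_superset hU fun y hy => D.loopFun_B_eq hy)

theorem lam_smul_maurerCartan_eq (v : ℂ) : ∃ B' ∈ diskMat, lam • maurerCartan F v w =
    (v • (loopFun (B w) * constMat (xiMat c w)) - lam • B') * (loopFun (B w)).adjugate := by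
  have hB := D.hasLineDerivAt_loopFun_B hw v
  refine ⟨_, hasLineDerivAt_mem_diskMat hB (Filter.mem_of_superset (D.isOpen.mem_nhds hw)
    fun y hy => D.loopFun_B_mem hy), ?_⟩
  have hdet : (loopFun (B w)).det = 1 := det_loopFun (D.continuous_B hw) (D.det_B hw)
  have hlam (M : CircMat) : lam • v • lamInv • M = v • M := by
    rw [smul_comm lam v, smul_smul lam, lam_mul_lamInv, one_smul]
  rw [smul_sub, mul_smul_comm, hlam, sub_sub_cancel, smul_mul_assoc, mul_assoc,
    mul_adjugate_of_det hdet, mul_one]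

theorem lam_smul_maurerCartan_mem (v : ℂ) : lam • maurerCartan F v w ∈ diskMat := by
  obtain ⟨B', hB', h⟩ := D.lam_smul_maurerCartan_eq hw v
  have hB := D.loopFun_B_mem hw
  rw [h]
  exact diskMat.mul_mem (diskMat.sub_mem
    (diskMat.smul_mem (diskMat.mul_mem hB (constMat_mem_diskMat _)) v)
    (lam_smul_mem_diskMat hB')) (adjugate_mem_diskMat hB)

theorem coefMat_maurerCartan (v : ℂ) :
    coefMat (-1) (maurerCartan F v w) = v • polarPart c B w := by
  obtain ⟨B', hB', h⟩ := D.lam_smul_maurerCartan_eq hw v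
  have hB := D.loopFun_B_mem hw
  have h0 : coefMat 0 (lam • B') = 0 := by
    rw [coefMat_lam_smul]
    exact coefMat_eq_zero_of_neg hB' (by norm_num)
  rw [← zero_sub, ← coefMat_lam_smul, h, coefMat_zero_mul (diskMat.sub_mem
    (diskMat.smul_mem (diskMat.mul_mem hB (constMat_mem_diskMat _)) v)
    (lam_smul_mem_diskMat hB')) (adjugate_mem_diskMat hB), coefMat_sub, h0, sub_zero, coefMat_smul,
    coefMat_mul_constMat, coefMat_adjugate, smul_mul_assoc, polarPart]

theorem isTwisted_dirDeriv (v : ℂ) : IsTwisted (dirDeriv F v w) := by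
  refine isTwisted_iff.2 fun l => ?_
  have h : HasLineDerivAt ℝ (fun w => sigma3 * F w l * sigma3)
      (sigma3 * dirDeriv F v w l * sigma3) w v :=
    HasDerivAt.mul_const (HasDerivAt.const_mul sigma3 (D.smooth.hasLineDerivAt D.isOpen hw v l))
      sigma3
  exact (D.smooth.hasLineDerivAt D.isOpen hw v _).unique (h.congr_of_eventuallyEq
    (Filter.mem_of_superset (D.isOpen.mem_nhds hw) fun y hy => isTwisted_iff.1 (D.twisted y hy) l))

theorem reality_dirDeriv (v : ℂ) (l : Circle) :
    reality T (dirDeriv F v w l) = dirDeriv F v w l := by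
  have h := D.smooth.hasLineDerivAt D.isOpen hw v l
  have h' : HasLineDerivAt ℝ (fun w => reality T (F w l)) (reality T (dirDeriv F v w l)) w v :=
    hasDerivAt_reality T h
  exact h'.unique (h.congr_of_eventuallyEq
    (Filter.mem_of_superset (D.isOpen.mem_nhds hw) fun y hy => D.reality_F y hy l))

theorem reality_maurerCartan (v : ℂ) : reality T (maurerCartan F v w) = maurerCartan F v w := by
  refine ext_map_ev fun l => ?_
  rw [map_ev_reality, D.map_ev_maurerCartan hw, reality_mul, reality_adjugate, D.reality_F w hw,
    D.reality_dirDeriv hw]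

theorem isTwisted_maurerCartan (v : ℂ) :
    IsTwisted fun l => (maurerCartan F v w).map (ev l) := by
  simp only [D.map_ev_maurerCartan hw]
  exact (D.twisted w hw).adjugate.mul (D.isTwisted_dirDeriv hw v)

theorem exists_maurerCartan_eq (v : ℂ) : ∃ D₀ : Mat2, Commute sigma3 D₀ ∧ ∀ l : Circle,
    (maurerCartan F v w).map (ev l) = (l : ℂ)⁻¹ • v • polarPart c B w + D₀ +
      (l : ℂ) • reality T (v • polarPart c B w) := by
  have h := eq_laurent_of_reality (D.lam_smul_maurerCartan_mem hw v) (D.reality_maurerCartan hw v)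
  rw [D.coefMat_maurerCartan hw] at h
  refine ⟨coefMat 0 (maurerCartan F v w),
    commute_sigma3_coefMat_zero (D.isTwisted_maurerCartan hw v), fun l => ?_⟩
  have hadd (M N : CircMat) : (M + N).map (ev l) = M.map (ev l) + N.map (ev l) :=
    Matrix.map_add _ (map_add _) M N
  refine (congrArg (fun M : CircMat => M.map (ev l)) h).trans ?_
  rw [hadd, hadd, map_ev_smul, map_ev_smul]
  simp only [map_ev_constMat, lamInv_apply, lam_apply]

theorem det_coefMat_B : (coefMat 0 (loopFun (B w))).det = 1 :=
  det_coefMat_zero (D.loopFun_B_mem hw) (det_loopFun (D.continuous_B hw) (D.det_B hw))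

theorem det_polarPart : (polarPart c B w).det = -(c * Complex.exp w) := by
  rw [polarPart, det_mul, det_mul, det_adjugate, D.det_coefMat_B hw, det_xiMat]
  simp

theorem sigma3_mul_polarPart : sigma3 * polarPart c B w = -(polarPart c B w * sigma3) := by
  have hB : IsTwisted fun l => (loopFun (B w)).map (ev l) := by
    simp only [map_loopFun (D.continuous_B hw)]
    exact (D.pos w hw).1.2.1
  have hB' : IsTwisted fun l => (loopFun (B w)).adjugate.map (ev l) := by
    simpa only [map_ev_adjugate] using hB.adjugate
  have hA : sigma3 * xiMat c w = -(xiMat c w * sigma3) := by simp [sigma3, xiMat]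
  have h := (commute_sigma3_coefMat_zero hB).eq
  have h' := (commute_sigma3_coefMat_zero hB').eq
  rw [coefMat_adjugate] at h'
  rw [polarPart, ← mul_assoc, ← mul_assoc, h, mul_assoc _ sigma3, hA, mul_neg, neg_mul, mul_assoc,
    mul_assoc, h']
  simp only [mul_assoc]

end IsSplitting

/-! ### The derivative of the Sym formula -/

section SymPart

variable {T : SurfaceClass} {G P X : Mat2}

theorem reality_conj (hG : reality T G = G) (X : Mat2) :
    reality T (G * X * G.adjugate) = G * reality T X * G.adjugate := by
  rw [reality_mul, reality_mul, reality_adjugate, hG]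

/-- The matrix `Y` such that, up to a constant factor, the immersion given by the Sym formula has
the derivative `F (λ⁻¹ v Y - λ ρ(v Y)) F⁻¹` in the direction `v`, where `P` is the polar part of the
Maurer–Cartan form and `ρ` is `reality T`. -/
def symPart : SurfaceClass → Mat2 → Mat2
  | .cgcTimelike, P => P
  | _, P => P * (1 + sigma3)

theorem symPart_of_ne (hT : T ≠ .cgcTimelike) (P : Mat2) : symPart T P = P * (1 + sigma3) := by
  cases T <;> first | exact absurd rfl hT | rfl

/-- The inverse of `symPart T`, conjugation invariant, on the matrices `P` with `P² = a`. -/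
def polarOfSymPart : SurfaceClass → ℂ → Mat2 → Mat2
  | .cgcTimelike, _, Y => Y
  | T, a, Y => (1 / 2 : ℂ) • Y + (2 * a / (Y * reality T Y).trace) • reality T Y

theorem exists_eq_of_sigma3_mul_eq_neg (hP : sigma3 * P = -(P * sigma3)) :
    ∃ p q : ℂ, P = !![0, p; q, 0] := by
  have h : sigma3 * P * sigma3 = -P := by
    rw [hP, neg_mul, mul_assoc, sigma3_mul_sigma3, mul_one]
  rw [sigma3_mul_mul_sigma3] at h
  have h00 : P 0 0 = 0 := self_eq_neg.1 (congrFun (congrFun h 0) 0)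
  have h11 : P 1 1 = 0 := self_eq_neg.1 (congrFun (congrFun h 1) 1)
  refine ⟨P 0 1, P 1 0, ?_⟩
  nth_rw 1 [eta_fin_two P]
  rw [h00, h11]

theorem polarOfSymPart_symPart (hP : sigma3 * P = -(P * sigma3)) (hdet : P.det ≠ 0) :
    polarOfSymPart T (-P.det) (symPart T P) = P := by
  obtain ⟨p, q, rfl⟩ := exists_eq_of_sigma3_mul_eq_neg hP
  rw [det_fin_two_of, zero_mul, zero_sub] at hdet ⊢
  have hq : q ≠ 0 := fun h => hdet (by rw [h, mul_zero, neg_zero])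
  have hq' : (starRingEnd ℂ) q ≠ 0 := (map_ne_zero _).2 hq
  cases T <;> simp [symPart, polarOfSymPart, sigma3, reality, one_fin_two, trace_fin_two] <;>
    field_simp <;> exact ⟨by ring, by ring⟩

theorem polarOfSymPart_conj (hG : G.det = 1) (hr : reality T G = G) (a : ℂ) (Y : Mat2) :
    polarOfSymPart T a (G * Y * G.adjugate) = G * polarOfSymPart T a Y * G.adjugate := by
  have htr : (G * Y * G.adjugate * (G * reality T Y * G.adjugate)).trace =
      (Y * reality T Y).trace := by
    rw [show G * Y * G.adjugate * (G * reality T Y * G.adjugate) =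
      G * (Y * ((G.adjugate * G) * reality T Y) * G.adjugate) by simp only [mul_assoc],
      adjugate_mul_of_det hG, one_mul, trace_mul_comm, mul_assoc, adjugate_mul_of_det hG, mul_one]
  cases T <;>
    simp only [polarOfSymPart, reality_conj hr, htr, mul_add, add_mul, mul_smul_comm,
      smul_mul_assoc]

theorem conj_smul_sub_reality (hr : reality T G = G) (l : Circle) (v : ℂ) (X : Mat2) :
    G * ((l : ℂ)⁻¹ • v • X - (l : ℂ) • reality T (v • X)) * G.adjugate =
      (l : ℂ)⁻¹ • v • (G * X * G.adjugate) - (l : ℂ) • reality T (v • (G * X * G.adjugate)) := by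
  simp only [reality_smul, reality_conj hr, mul_sub, sub_mul, mul_smul_comm, smul_mul_assoc]

theorem eq_zero_of_smul_sub_reality_eq_zero {l : Circle}
    (h : ∀ v : ℂ, (l : ℂ)⁻¹ • v • X - (l : ℂ) • reality T (v • X) = 0) : X = 0 := by
  have h1 := h 1
  have h2 := h Complex.I
  simp only [reality_smul, one_smul, Complex.star_def, Complex.conj_I] at h1 h2
  have h3 : (2 * Complex.I * (l : ℂ)⁻¹) • X = 0 := by
    calc (2 * Complex.I * (l : ℂ)⁻¹) • X
        = Complex.I • ((l : ℂ)⁻¹ • X - (l : ℂ) • reality T X) +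
          ((l : ℂ)⁻¹ • Complex.I • X - (l : ℂ) • -Complex.I • reality T X) := by module
      _ = 0 := by rw [h1, h2, smul_zero, add_zero]
  exact (smul_eq_zero.1 h3).resolve_left (by simp [l.coe_ne_zero])

theorem hasDerivAt_exp_mul (l : Circle) :
    HasDerivAt (fun t : ℝ => ((Circle.exp t * l : Circle) : ℂ)) (Complex.I * l) 0 := by
  have h : HasDerivAt (fun t : ℝ => Complex.exp (t * Complex.I)) Complex.I 0 := by
    simpa using ((hasDerivAt_id (0 : ℝ)).ofReal_comp.mul_const Complex.I).cexp
  simpa only [Circle.coe_mul, Circle.coe_exp] using h.mul_const (l : ℂ)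

theorem hasDerivAt_inv_exp_mul (l : Circle) :
    HasDerivAt (fun t : ℝ => ((Circle.exp t * l : Circle) : ℂ)⁻¹) (-Complex.I * (l : ℂ)⁻¹) 0 := by
  refine ((hasDerivAt_exp_mul l).fun_inv (Circle.coe_ne_zero _)).congr_deriv ?_
  rw [Circle.exp_zero, _root_.one_mul]
  field_simp [l.coe_ne_zero]

end SymPart

/-- The matrix `F Y F⁻¹` that determines the derivative of the immersion, see `symPart`. -/
def symForm (T : SurfaceClass) (c : ℂ) (F B : ℂ → Loop) (l : Circle) (w : ℂ) : Mat2 :=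
  F w l * symPart T (polarPart c B w) * (F w l).adjugate

namespace IsSplitting

variable {T : SurfaceClass} {c : ℂ} {U : Set ℂ} {L F B : ℂ → Loop} (D : IsSplitting T c U L F B)
  {w : ℂ} (hw : w ∈ U) (v : ℂ) (l : Circle)

include D hw

theorem hasLineDerivAt_adjugate :
    HasLineDerivAt ℝ (fun w => (F w l).adjugate)
      (-((maurerCartan F v w).map (ev l) * (F w l).adjugate)) w v := by
  have h := hasLineDerivAt_adjugate_of_det (D.smooth.hasLineDerivAt D.isOpen hw v l)
    (Filter.mem_of_superset (D.isOpen.mem_nhds hw) fun y hy => D.det_F y hy l)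
  rw [← D.map_ev_maurerCartan hw] at h
  exact h

theorem hasLineDerivAt_conj (A : Mat2) :
    HasLineDerivAt ℝ (fun w => F w l * A * (F w l).adjugate)
      (F w l * ((maurerCartan F v w).map (ev l) * A - A * (maurerCartan F v w).map (ev l)) *
        (F w l).adjugate) w v := by
  have hF := D.smooth.hasLineDerivAt D.isOpen hw v l
  have hFA : HasLineDerivAt ℝ (fun w => F w l * A) (dirDeriv F v w l * A) w v :=
    HasDerivAt.mul_const hF A
  refine HasDerivAt.congr_deriv
    (hasLineDerivAt_mul hFA (D.hasLineDerivAt_adjugate hw v l)) ?_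
  rw [D.dirDeriv_eq_mul hw]
  noncomm_ring

theorem angleDeriv_dirDeriv : angleDeriv (dirDeriv F v w) l =
    angleDeriv (F w) l * (maurerCartan F v w).map (ev l) - F w l * (Complex.I •
      ((l : ℂ)⁻¹ • v • polarPart c B w - (l : ℂ) • reality T (v • polarPart c B w))) := by
  obtain ⟨D₀, -, hα⟩ := D.exists_maurerCartan_eq hw v
  have hcongr : ∀ t : ℝ, dirDeriv F v w (Circle.exp t * l) = F w (Circle.exp t * l) *
      (((Circle.exp t * l : Circle) : ℂ)⁻¹ • v • polarPart c B w + D₀ +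
        ((Circle.exp t * l : Circle) : ℂ) • reality T (v • polarPart c B w)) := fun t => by
    rw [D.dirDeriv_eq_mul hw, hα]
  have hα' : HasDerivAt (fun t : ℝ => ((Circle.exp t * l : Circle) : ℂ)⁻¹ • v • polarPart c B w +
      D₀ + ((Circle.exp t * l : Circle) : ℂ) • reality T (v • polarPart c B w))
      ((-Complex.I * (l : ℂ)⁻¹) • v • polarPart c B w +
        (Complex.I * l) • reality T (v • polarPart c B w)) 0 :=
    (((hasDerivAt_inv_exp_mul l).smul_const _).add_const D₀).add
      ((hasDerivAt_exp_mul l).smul_const _)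
  have h := (D.smooth.hasDerivAt_angle D.isOpen hw l).mul hα'
  refine (h.congr_of_eventuallyEq (.of_forall hcongr)).deriv.trans ?_
  simp only [Circle.exp_zero, _root_.one_mul, hα]
  generalize v • polarPart c B w = X
  rw [sub_eq_add_neg, ← mul_neg]
  congr 2
  module

theorem hasLineDerivAt_angleDeriv_mul_adjugate :
    HasLineDerivAt ℝ (fun w => angleDeriv (F w) l * (F w l).adjugate)
      (-(Complex.I • (F w l * ((l : ℂ)⁻¹ • v • polarPart c B w -
        (l : ℂ) • reality T (v • polarPart c B w)) * (F w l).adjugate))) w v := by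
  have h := hasLineDerivAt_mul (D.smooth.hasLineDerivAt_angleDeriv D.isOpen hw v l)
    (D.hasLineDerivAt_adjugate hw v l)
  rw [D.angleDeriv_dirDeriv hw, sub_mul, mul_smul_comm, smul_mul_assoc, mul_neg, mul_assoc,
    sub_add_eq_add_sub, add_neg_cancel, zero_sub] at h
  exact h

omit v in
theorem symMap_cgcTimelike (H : ℝ) :
    symMap H .cgcTimelike (F w) l = -(angleDeriv (F w) l * (F w l).adjugate) := by
  simp only [symMap]
  rw [lambdaDeriv_eq (D.smooth.hasDerivAt_angle D.isOpen hw l).differentiableAt,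
    inv_eq_adjugate (D.det_F w hw l), smul_mul_assoc, smul_smul, neg_mul_neg, Complex.I_mul_I,
    neg_one_smul]

omit v in
theorem symMap_of_ne (hT : T ≠ .cgcTimelike) (H : ℝ) :
    symMap H T (F w) l = (-Complex.I / (2 * H)) • (F w l * sigma3 * (F w l).adjugate +
      (2 * Complex.I) • (angleDeriv (F w) l * (F w l).adjugate)) := by
  have h : lambdaDeriv (F w) l * (F w l)⁻¹ =
      -Complex.I • (angleDeriv (F w) l * (F w l).adjugate) := by
    rw [lambdaDeriv_eq (D.smooth.hasDerivAt_angle D.isOpen hw l).differentiableAt,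
      inv_eq_adjugate (D.det_F w hw l), smul_mul_assoc]
  rw [← inv_eq_adjugate (D.det_F w hw l)] at h ⊢
  cases T <;> first | exact absurd rfl hT | simp only [symMap, h]; module

theorem maurerCartan_sigma3_commutator (hT : T ≠ .cgcTimelike) :
    (maurerCartan F v w).map (ev l) * sigma3 - sigma3 * (maurerCartan F v w).map (ev l) =
      (2 : ℂ) • (((l : ℂ)⁻¹ • v • polarPart c B w + (l : ℂ) • reality T (v • polarPart c B w)) *
        sigma3) := by
  obtain ⟨D₀, hD₀, hα⟩ := D.exists_maurerCartan_eq hw v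
  have hP := D.sigma3_mul_polarPart hw
  have hρP : sigma3 * reality T (polarPart c B w) = -(reality T (polarPart c B w) * sigma3) := by
    have h := congrArg (reality T) hP
    rw [reality_neg, reality_mul, reality_mul, reality_sigma3 hT, neg_mul, mul_neg, neg_neg] at h
    rw [← h, neg_neg]
  rw [hα, mul_add, mul_add, add_mul, add_mul, ← hD₀.eq]
  simp only [reality_smul, mul_smul_comm, smul_mul_assoc, add_mul, hP, hρP]
  module

theorem hasLineDerivAt_symMap_of_ne (hT : T ≠ .cgcTimelike) (H : ℝ) :
    HasLineDerivAt ℝ (fun w => symMap H T (F w) l)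
      ((-Complex.I / H) • ((l : ℂ)⁻¹ • v • symForm T c F B l w -
        (l : ℂ) • reality T (v • symForm T c F B l w))) w v := by
  have h := hasLineDerivAt_const_smul (-Complex.I / (2 * H)) <|
    hasLineDerivAt_add (D.hasLineDerivAt_conj hw v l sigma3) <|
      hasLineDerivAt_const_smul (2 * Complex.I) (D.hasLineDerivAt_angleDeriv_mul_adjugate hw v l)
  have hY : (2 : ℂ) • ((l : ℂ)⁻¹ • v • symPart T (polarPart c B w) -
      (l : ℂ) • reality T (v • symPart T (polarPart c B w))) =
      ((maurerCartan F v w).map (ev l) * sigma3 - sigma3 * (maurerCartan F v w).map (ev l)) +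
        (2 : ℂ) • ((l : ℂ)⁻¹ • v • polarPart c B w -
          (l : ℂ) • reality T (v • polarPart c B w)) := by
    rw [D.maurerCartan_sigma3_commutator hw v l hT, symPart_of_ne hT]
    simp only [reality_smul, reality_mul, reality_add, reality_sigma3 hT, mul_add,
      add_mul, mul_one, mul_neg, smul_mul_assoc]
    module
  rw [eq_sub_of_add_eq hY.symm] at h
  rw [symForm, ← conj_smul_sub_reality (D.reality_F w hw l)]
  refine HasDerivAt.congr_deriv (h.congr_of_eventuallyEq (Filter.mem_of_superset
    (D.isOpen.mem_nhds hw) fun y hy => D.symMap_of_ne hy l hT H)) ?_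
  have hI (M : Mat2) : (2 * Complex.I) • -(Complex.I • M) = (2 : ℂ) • M := by
    rw [smul_neg, smul_smul, mul_assoc, Complex.I_mul_I, ← neg_smul, mul_neg_one, neg_neg]
  rw [hI]
  generalize (l : ℂ)⁻¹ • v • symPart T (polarPart c B w) - _ = W
  generalize (l : ℂ)⁻¹ • v • polarPart c B w - _ = Z
  simp only [mul_sub, sub_mul, mul_smul_comm, smul_mul_assoc]
  module

theorem hasLineDerivAt_symMap_cgcTimelike (hT : T = .cgcTimelike) (H : ℝ) :
    HasLineDerivAt ℝ (fun w => symMap H T (F w) l)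
      (Complex.I • ((l : ℂ)⁻¹ • v • symForm T c F B l w -
        (l : ℂ) • reality T (v • symForm T c F B l w))) w v := by
  subst hT
  have h : HasLineDerivAt ℝ (fun w => -(angleDeriv (F w) l * (F w l).adjugate)) _ w v :=
    HasDerivAt.neg (D.hasLineDerivAt_angleDeriv_mul_adjugate hw v l)
  rw [neg_neg, conj_smul_sub_reality (D.reality_F w hw l)] at h
  exact h.congr_of_eventuallyEq (Filter.mem_of_superset (D.isOpen.mem_nhds hw)
    fun y hy => D.symMap_cgcTimelike hy l H)

omit hw v in
theorem exists_hasLineDerivAt_symMap {H : ℝ} (hH : H ≠ 0) : ∃ a : ℂ, a ≠ 0 ∧ ∀ w ∈ U, ∀ v,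
    HasLineDerivAt ℝ (fun w => symMap H T (F w) l)
      (a • ((l : ℂ)⁻¹ • v • symForm T c F B l w -
        (l : ℂ) • reality T (v • symForm T c F B l w))) w v := by
  by_cases hT : T = .cgcTimelike
  · exact ⟨Complex.I, Complex.I_ne_zero,
      fun w hw v => D.hasLineDerivAt_symMap_cgcTimelike hw v l hT H⟩
  · exact ⟨-Complex.I / H, by simp [hH],
      fun w hw v => D.hasLineDerivAt_symMap_of_ne hw v l hT H⟩

omit v in
theorem symForm_add_period {H : ℝ} (hH : H ≠ 0) {τ : ℂ} (hτ : ∀ w ∈ U, w + τ ∈ U)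
    (hf : ∀ w ∈ U, symMap H T (F (w + τ)) l = symMap H T (F w) l) :
    symForm T c F B l (w + τ) = symForm T c F B l w := by
  obtain ⟨a, ha, h⟩ := D.exists_hasLineDerivAt_symMap l hH
  refine sub_eq_zero.1 (eq_zero_of_smul_sub_reality_eq_zero (T := T) (l := l) fun v => ?_)
  have hshift : HasLineDerivAt ℝ (fun w => symMap H T (F (w + τ)) l)
      (a • ((l : ℂ)⁻¹ • v • symForm T c F B l (w + τ) -
        (l : ℂ) • reality T (v • symForm T c F B l (w + τ)))) w v :=
    hasLineDerivAt_comp_add_right (h (w + τ) (hτ w hw) v)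
  have huniq := smul_right_injective Mat2 ha <| (h w hw v).unique <|
    hshift.congr_of_eventuallyEq <| Filter.mem_of_superset (D.isOpen.mem_nhds hw)
      fun y hy => (hf y hy).symm
  rw [smul_sub v, sub_eq_add_neg (v • _), reality_add, reality_neg, ← sub_eq_zero.2 huniq.symm]
  module

omit v in
theorem polarOfSymPart_symForm :
    polarOfSymPart T (c * Complex.exp w) (symForm T c F B l w) =
      F w l * polarPart c B w * (F w l).adjugate := by
  have hdet := D.det_polarPart hw
  have h := polarOfSymPart_symPart (T := T) (D.sigma3_mul_polarPart hw)
    (by rw [hdet]; exact neg_ne_zero.2 (mul_ne_zero D.c_ne_zero (Complex.exp_ne_zero w)))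
  rw [hdet, neg_neg] at h
  rw [symForm, polarOfSymPart_conj (D.det_F w hw l) (D.reality_F w hw l), h]

omit v in
theorem conj_polarPart_add_period {H : ℝ} (hH : H ≠ 0) {n : ℤ}
    (hn : ∀ w ∈ U, w + 2 * Real.pi * Complex.I * n ∈ U)
    (hf : ∀ w ∈ U, symMap H T (F (w + 2 * Real.pi * Complex.I * n)) l = symMap H T (F w) l) :
    F (w + 2 * Real.pi * Complex.I * n) l * polarPart c B (w + 2 * Real.pi * Complex.I * n) *
      (F (w + 2 * Real.pi * Complex.I * n) l).adjugate =
      F w l * polarPart c B w * (F w l).adjugate := by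
  rw [← D.polarOfSymPart_symForm hw, ← D.polarOfSymPart_symForm (hn w hw),
    D.symForm_add_period hw l hH hn hf, exp_add_two_pi_mul_I_mul_int]

end IsSplitting

/-! ### The associated family relative to the closed member -/

/-- The frame `F_{l'}` of a member of the associated family, relative to the frame at `l`. -/
def relFrame (F : ℂ → Loop) (l l' : Circle) (w : ℂ) : Mat2 := F w l' * (F w l).adjugate

namespace IsSplitting

variable {T : SurfaceClass} {c : ℂ} {U : Set ℂ} {L F B : ℂ → Loop} (D : IsSplitting T c U L F B)
  {w : ℂ} (hw : w ∈ U) (v : ℂ) (l l' : Circle)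

include D hw

omit v in
theorem det_relFrame : (relFrame F l l' w).det = 1 := by
  rw [relFrame, det_mul, det_adjugate, D.det_F w hw, D.det_F w hw, Fintype.card_fin]
  norm_num

omit v in
theorem relFrame_self : relFrame F l l w = 1 := mul_adjugate_of_det (D.det_F w hw l)

theorem hasLineDerivAt_relFrame :
    HasLineDerivAt ℝ (relFrame F l l') (relFrame F l l' w *
      (((l' : ℂ)⁻¹ - (l : ℂ)⁻¹) • v • (F w l * polarPart c B w * (F w l).adjugate) +
        ((l' : ℂ) - l) • reality T (v • (F w l * polarPart c B w * (F w l).adjugate)))) w v := by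
  have h := hasLineDerivAt_mul (D.smooth.hasLineDerivAt D.isOpen hw v l')
    (D.hasLineDerivAt_adjugate hw v l)
  refine HasDerivAt.congr_deriv h ?_
  obtain ⟨D₀, -, hα⟩ := D.exists_maurerCartan_eq hw v
  have hconj : reality T (v • (F w l * polarPart c B w * (F w l).adjugate)) =
      F w l * reality T (v • polarPart c B w) * (F w l).adjugate := by
    rw [reality_smul, reality_smul, reality_conj (D.reality_F w hw l), mul_smul_comm,
      smul_mul_assoc]
  have hF (X Y : Mat2) : relFrame F l l' w * (F w l * X * Y) = F w l' * X * Y := by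
    rw [relFrame, mul_assoc (F w l) X, mul_assoc (F w l'), ← mul_assoc _ (F w l),
      adjugate_mul_of_det (D.det_F w hw l), one_mul, mul_assoc]
  rw [D.dirDeriv_eq_mul hw, hα, hα, hconj]
  simp only [mul_add, mul_smul_comm, hF]
  simp only [mul_add, add_mul, mul_neg, mul_smul_comm, smul_mul_assoc, ← mul_assoc]
  module

theorem hasLineDerivAt_adjugate_relFrame :
    HasLineDerivAt ℝ (fun w => (relFrame F l l' w).adjugate)
      (-((((l' : ℂ)⁻¹ - (l : ℂ)⁻¹) • v • (F w l * polarPart c B w * (F w l).adjugate) +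
        ((l' : ℂ) - l) • reality T (v • (F w l * polarPart c B w * (F w l).adjugate))) *
          (relFrame F l l' w).adjugate)) w v := by
  have h := hasLineDerivAt_adjugate_of_det (D.hasLineDerivAt_relFrame hw v l l')
    (Filter.mem_of_superset (D.isOpen.mem_nhds hw) fun y hy => D.det_relFrame hy l l')
  rw [← mul_assoc, adjugate_mul_of_det (D.det_relFrame hw l l'), one_mul] at h
  exact h

omit v in
theorem differentiableAt_relFrame : DifferentiableAt ℝ (relFrame F l l') w :=
  (D.smooth.differentiableAt D.isOpen hw l').mul
    (differentiableAt_adjugate (D.smooth.differentiableAt D.isOpen hw l))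

omit hw v in
theorem relFrame_add_period_mul_adjugate {τ : ℂ} (hτ : ∀ w ∈ U, w + τ ∈ U)
    (hP : ∀ w ∈ U, F (w + τ) l * polarPart c B (w + τ) * (F (w + τ) l).adjugate =
      F w l * polarPart c B w * (F w l).adjugate) {w₀ : ℂ} (hw : w ∈ U) (hw₀ : w₀ ∈ U) :
    relFrame F l l' (w + τ) * (relFrame F l l' w).adjugate =
      relFrame F l l' (w₀ + τ) * (relFrame F l l' w₀).adjugate := by
  have hd : ∀ w ∈ U, DifferentiableAt ℝ
      (fun w => relFrame F l l' (w + τ) * (relFrame F l l' w).adjugate) w := fun w hw =>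
    ((differentiableAt_comp_add_right τ).2 (D.differentiableAt_relFrame (hτ w hw) l l')).mul
      (differentiableAt_adjugate (D.differentiableAt_relFrame hw l l'))
  refine D.isOpen.is_const_of_fderiv_eq_zero D.isPreconnected
    (fun w hw => (hd w hw).differentiableWithinAt) (fun w hw => ?_) hw hw₀
  ext1 v
  have h := hasLineDerivAt_mul (hasLineDerivAt_comp_add_right
    (D.hasLineDerivAt_relFrame (hτ w hw) v l l')) (D.hasLineDerivAt_adjugate_relFrame hw v l l')
  rw [hP w hw, mul_neg, mul_assoc, add_neg_cancel] at h
  rw [← (hd w hw).lineDeriv_eq_fderiv]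
  exact h.lineDeriv

end IsSplitting

/-! ### Killing fields in the disk algebra -/

/-- A trace-free solution over `U` of the Lax equation `dX = [X, α]` for the potential
`α = λ⁻¹ A dw`, `A = xiMat c w`, that extends holomorphically to the disk `|λ| < 1`. -/
structure IsKilling (c : ℂ) (U : Set ℂ) (X : ℂ → CircMat) : Prop where
  mem : ∀ w ∈ U, X w ∈ diskMat
  trace : ∀ w ∈ U, (X w).trace = 0
  hasDerivAt : ∀ w ∈ U, HasDerivAt X
    (lamInv • (X w * constMat (xiMat c w) - constMat (xiMat c w) * X w)) w

theorem hasDerivAt_trace {X : ℂ → Mat2} {X' : Mat2} {w : ℂ} (h : HasDerivAt X X' w) :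
    HasDerivAt (fun w => (X w).trace) X'.trace w := by
  simp only [trace_fin_two]
  exact (hasDerivAt_matrix.1 h 0 0).add (hasDerivAt_matrix.1 h 1 1)

theorem hasDerivAt_coefMat {X : ℂ → CircMat} {X' : CircMat} {w : ℂ} (h : HasDerivAt X X' w)
    (n : ℤ) : HasDerivAt (fun w => coefMat n (X w)) (coefMat n X') w :=
  hasDerivAt_matrix.2 fun i j =>
    (coef n).hasFDerivAt.comp_hasDerivAt w (hasDerivAt_matrix.1 h i j)

theorem trace_coefMat (n : ℤ) (M : CircMat) : (coefMat n M).trace = coef n M.trace := by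
  simp [trace_fin_two, coefMat]

namespace IsKilling

variable {c : ℂ} {U : Set ℂ} {X Y : ℂ → CircMat}

theorem add_period (hX : IsKilling c U X) {n : ℤ}
    (hn : ∀ w ∈ U, w + 2 * Real.pi * Complex.I * n ∈ U) :
    IsKilling c U fun w => X (w + 2 * Real.pi * Complex.I * n) where
  mem w hw := hX.mem _ (hn w hw)
  trace w hw := hX.trace _ (hn w hw)
  hasDerivAt w hw := by
    have h := (hX.hasDerivAt _ (hn w hw)).comp_add_const w _
    rw [xiMat_add_period] at h
    exact h

theorem commutator (hX : IsKilling c U X) (hY : IsKilling c U Y) :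
    IsKilling c U fun w => X w * Y w - Y w * X w where
  mem w hw := diskMat.sub_mem (diskMat.mul_mem (hX.mem w hw) (hY.mem w hw))
    (diskMat.mul_mem (hY.mem w hw) (hX.mem w hw))
  trace w _ := by rw [trace_sub, trace_mul_comm, sub_self]
  hasDerivAt w hw := by
    have hx := hX.hasDerivAt w hw
    have hy := hY.hasDerivAt w hw
    refine ((hx.mul hy).sub (hy.mul hx)).congr_deriv ?_
    simp only [smul_mul_assoc, mul_smul_comm, ← smul_add, ← smul_sub]
    congr 1
    noncomm_ring

theorem hasDerivAt_coefMat (hX : IsKilling c U X) {w : ℂ} (hw : w ∈ U) (n : ℤ) :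
    HasDerivAt (fun w => coefMat n (X w))
      (coefMat (n + 1) (X w) * xiMat c w - xiMat c w * coefMat (n + 1) (X w)) w := by
  have h := DPW.hasDerivAt_coefMat (hX.hasDerivAt w hw) n
  rw [coefMat_lamInv_smul, coefMat_sub, coefMat_mul_constMat, coefMat_constMat_mul] at h
  exact h

theorem trace_coefMat (hX : IsKilling c U X) {w : ℂ} (hw : w ∈ U) (n : ℤ) :
    (coefMat n (X w)).trace = 0 := by
  rw [DPW.trace_coefMat, hX.trace w hw, map_zero]

/-- The leading coefficient commutes with `A`, because the coefficient below it vanishes. -/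
theorem commute_coefMat (hX : IsKilling c U X) (hU : IsOpen U) {n : ℤ}
    (h : ∀ w ∈ U, coefMat n (X w) = 0) {w : ℂ} (hw : w ∈ U) :
    Commute (xiMat c w) (coefMat (n + 1) (X w)) := by
  have h0 : HasDerivAt (fun w => coefMat n (X w)) 0 w :=
    (hasDerivAt_const w 0).congr_of_eventuallyEq (Filter.mem_of_superset (hU.mem_nhds hw) h)
  exact (sub_eq_zero.1 ((hX.hasDerivAt_coefMat hw n).unique h0)).symm

theorem trace_coefMat_sq_const (hX : IsKilling c U X) (hU : IsOpen U) (hUc : IsPreconnected U)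
    {n : ℤ} (h : ∀ w ∈ U, Commute (xiMat c w) (coefMat n (X w))) {w w₀ : ℂ} (hw : w ∈ U)
    (hw₀ : w₀ ∈ U) :
    (coefMat n (X w) * coefMat n (X w)).trace = (coefMat n (X w₀) * coefMat n (X w₀)).trace := by
  have hd : ∀ w ∈ U, HasDerivAt (fun w => (coefMat n (X w) * coefMat n (X w)).trace) 0 w := by
    intro w hw
    have hX' := hX.hasDerivAt_coefMat hw n
    refine (hasDerivAt_trace (hX'.mul hX')).congr_deriv ?_
    generalize coefMat (n + 1) (X w) = Y
    have hM := (h w hw).eq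
    rw [trace_add, trace_mul_comm (coefMat n (X w)), ← two_mul, sub_mul, trace_sub, mul_assoc, hM,
      trace_mul_comm, ← trace_mul_cycle, sub_self, mul_zero]
  exact hU.is_const_of_deriv_eq_zero hUc
    (fun w hw => (hd w hw).differentiableAt.differentiableWithinAt) (fun w hw => (hd w hw).deriv) hw
    hw₀

theorem exists_leading (hX : IsKilling c U X) (hc : c ≠ 0) (hU : IsOpen U) (hUc : IsPreconnected U)
    (hne : ∃ w ∈ U, X w ≠ 0) : ∃ m : ℕ, ∀ w ∈ U, (∀ k < m, coefMat k (X w) = 0) ∧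
      ∃ a : ℂ, a ≠ 0 ∧ coefMat m (X w) = a • xiMat c w := by
  classical
  have hex : ∃ m : ℕ, ∃ w ∈ U, coefMat m (X w) ≠ 0 := by
    by_contra! h
    obtain ⟨w, hw, hX0⟩ := hne
    refine hX0 (eq_zero_of_coefMat_eq_zero fun n => ?_)
    rcases lt_or_ge n 0 with hn | hn
    · exact coefMat_eq_zero_of_neg (hX.mem w hw) hn
    · lift n to ℕ using hn
      exact h n w hw
  obtain ⟨w₁, hw₁, hne₁⟩ := Nat.find_spec hex
  have hmin : ∀ k < Nat.find hex, ∀ w ∈ U, coefMat k (X w) = 0 := fun k hk => by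
    simpa using Nat.find_min hex hk
  generalize Nat.find hex = m at hne₁ hmin
  have hbelow : ∀ w ∈ U, coefMat ((m : ℤ) - 1) (X w) = 0 := fun w hw => by
    rcases m with _ | m
    · exact coefMat_eq_zero_of_neg (hX.mem w hw) (by simp)
    · simpa using hmin m m.lt_succ_self w hw
  have hcomm : ∀ w ∈ U, Commute (xiMat c w) (coefMat m (X w)) := fun w hw => by
    simpa using hX.commute_coefMat hU hbelow hw
  have hdet (w : ℂ) : (xiMat c w).det ≠ 0 := by simp [det_xiMat, hc]
  have hsmul : ∀ w ∈ U, ∃ a : ℂ, coefMat m (X w) = a • xiMat c w := fun w hw =>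
    exists_eq_smul_of_commute (trace_xiMat c w) (hdet w) (hX.trace_coefMat hw m) (hcomm w hw)
  refine ⟨m, fun w hw => ⟨fun k hk => hmin k hk w hw, ?_⟩⟩
  obtain ⟨a, ha⟩ := hsmul w hw
  refine ⟨a, ?_, ha⟩
  rintro rfl
  obtain ⟨b, hb⟩ := hsmul w₁ hw₁
  have hconst := hX.trace_coefMat_sq_const hU hUc hcomm hw hw₁
  rw [ha, hb, zero_smul, zero_mul, trace_zero, smul_mul_smul_comm,
    mul_self_of_trace_eq_zero (trace_xiMat c w₁), trace_smul, trace_smul, trace_one] at hconst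
  have hb0 : b = 0 := by simpa [hdet w₁] using hconst
  exact hne₁ (by rw [hb, hb0, zero_smul])

theorem trace_mul_ne_zero (hX : IsKilling c U X) (hY : IsKilling c U Y) (hc : c ≠ 0) (hU : IsOpen U)
    (hUc : IsPreconnected U) (hX0 : ∃ w ∈ U, X w ≠ 0) (hY0 : ∃ w ∈ U, Y w ≠ 0) {w : ℂ}
    (hw : w ∈ U) : (X w * Y w).trace ≠ 0 := by
  obtain ⟨m, hm⟩ := hX.exists_leading hc hU hUc hX0
  obtain ⟨n, hn⟩ := hY.exists_leading hc hU hUc hY0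
  obtain ⟨hXm, a, ha, hXa⟩ := hm w hw
  obtain ⟨hYn, b, hb, hYb⟩ := hn w hw
  intro h
  have h1 := DPW.trace_coefMat ((m + n : ℕ) : ℤ) (X w * Y w)
  rw [h, map_zero, coefMat_add_mul (hX.mem w hw) (hY.mem w hw) hXm hYn, hXa, hYb,
    smul_mul_smul_comm, mul_self_of_trace_eq_zero (trace_xiMat c w), trace_smul, trace_smul,
    trace_one, det_xiMat] at h1
  simp [ha, hb, hc] at h1

/-- The commutator is again a Killing field, and it is orthogonal to `X` for the trace form. -/
theorem commute (hX : IsKilling c U X) (hY : IsKilling c U Y) (hc : c ≠ 0) (hU : IsOpen U)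
    (hUc : IsPreconnected U) {w : ℂ} (hw : w ∈ U) : Commute (X w) (Y w) := by
  by_contra h
  have h0 : X w * Y w - Y w * X w ≠ 0 := sub_ne_zero.2 h
  have hX0 : X w ≠ 0 := fun hX0 => h0 (by rw [hX0, zero_mul, mul_zero, sub_zero])
  refine (hX.commutator hY).trace_mul_ne_zero hX hc hU hUc ⟨w, hw, h0⟩ ⟨w, hw, hX0⟩ hw ?_
  rw [sub_mul, trace_sub, mul_assoc, trace_mul_comm (X w), sub_self]

theorem exists_det_ne_zero (hX : IsKilling c U X) (hc : c ≠ 0) (hU : IsOpen U)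
    (hUc : IsPreconnected U) {w : ℂ} (hw : w ∈ U) (hX0 : X w ≠ 0) :
    ∃ l, ((X w).map (ev l)).det ≠ 0 := by
  by_contra! h
  refine hX.trace_mul_ne_zero hX hc hU hUc ⟨w, hw, hX0⟩ ⟨w, hw, hX0⟩ hw
    (ContinuousMap.ext fun l => ?_)
  have htr : ((X w).map (ev l)).trace = 0 := by
    rw [← trace_apply_circFun, hX.trace w hw, ContinuousMap.zero_apply]
  rw [trace_apply_circFun, map_ev_mul, mul_self_of_trace_eq_zero htr, h, neg_zero, zero_smul,
    trace_zero, ContinuousMap.zero_apply]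

end IsKilling

/-! ### The Killing field of a closed surface -/

namespace IsSplitting

variable {T : SurfaceClass} {c : ℂ} {U : Set ℂ} {L F B : ℂ → Loop} (D : IsSplitting T c U L F B)

include D

theorem isKilling_of_conj {X : ℂ → CircMat} {Z : Loop} (hmem : ∀ w ∈ U, X w ∈ diskMat)
    (hZ : ∀ l, (Z l).trace = 0)
    (hX : ∀ w ∈ U, ∀ l, (X w).map (ev l) = (L w l).adjugate * Z l * L w l) :
    IsKilling c U X where
  mem := hmem
  trace w hw := by
    ext l
    rw [trace_apply_circFun, hX w hw, trace_mul_comm, ← mul_assoc,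
      mul_adjugate_of_det (D.det_L hw l), one_mul, hZ, ContinuousMap.zero_apply]
  hasDerivAt w hw := by
    have hdet : ∀ y ∈ U, (loopFun (L y)).det = 1 := fun y hy =>
      det_loopFun (D.continuous_L hy) (D.det_L hy)
    have hU := D.isOpen.mem_nhds hw
    set C := loopFun (L w) * X w * (loopFun (L w)).adjugate with hC
    have hXC : ∀ y ∈ U, X y = (loopFun (L y)).adjugate * C * loopFun (L y) := fun y hy => by
      refine ext_map_ev fun l => ?_
      have hCl : C.map (ev l) = Z l := by
        rw [hC, map_ev_mul, map_ev_mul, map_ev_adjugate, map_loopFun (D.continuous_L hw), hX w hw,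
          mul_conj_mul_adjugate (D.det_L hw l)]
      rw [map_ev_mul, map_ev_mul, map_ev_adjugate, map_loopFun (D.continuous_L hy), hCl, hX y hy]
    have hL := D.hasDerivAt_loopFun_L hw
    have hL' := hasDerivAt_adjugate_of_det hL (Filter.mem_of_superset hU hdet)
    have h := ((hL'.mul_const C).mul hL).congr_of_eventuallyEq (Filter.mem_of_superset hU hXC)
    refine h.congr_deriv ?_
    rw [hXC w hw, ← mul_assoc _ (loopFun (L w)), adjugate_mul_of_det (hdet w hw), one_mul]
    simp only [neg_mul, mul_smul_comm, smul_mul_assoc, smul_sub, mul_assoc]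
    abel

/-- The field `B(w)⁻¹ F_l(w)⁻¹ F_l(w + τ) B(w + τ)`, which extends holomorphically to `|λ| < 1`. It
is the conjugate under `L` of the monodromy of `L` for the period `τ`, corrected by the change of
the associated family. -/
def periodField (F B : ℂ → Loop) (l : Circle) (τ w : ℂ) : CircMat :=
  (loopFun (B w)).adjugate * constMat ((F w l).adjugate * F (w + τ) l) * loopFun (B (w + τ))

theorem map_ev_periodField {τ : ℂ} (hw : w ∈ U) (hτ : w + τ ∈ U) (l l' : Circle) :
    (periodField F B l τ w).map (ev l') =
      (L w l').adjugate * (relFrame F l l' (w + τ) * (relFrame F l l' w).adjugate).adjugate *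
        L (w + τ) l' := by
  have hB (y : ℂ) (hy : y ∈ U) : (loopFun (B y)).map (ev l') = (F y l').adjugate * L y l' := by
    rw [D.loopFun_B_eq hy, map_ev_mul, map_ev_adjugate, map_loopFun (D.continuous_F hy),
      map_loopFun (D.continuous_L hy)]
  simp only [periodField, map_ev_mul, map_ev_adjugate, map_ev_constMat, hB w hw, hB _ hτ, relFrame,
    adjugate_mul_distrib, adjugate_adjugate_fin_two, mul_assoc]

theorem periodField_mem {τ : ℂ} (hw : w ∈ U) (hτ : w + τ ∈ U) (l : Circle) :
    periodField F B l τ w ∈ diskMat :=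
  diskMat.mul_mem (diskMat.mul_mem (adjugate_mem_diskMat (D.loopFun_B_mem hw))
    (constMat_mem_diskMat _)) (D.loopFun_B_mem hτ)

variable {n : ℤ} {l : Circle}

/-- The field is the trace-free part of `periodField`. At `λ = l` the associated family does not
change, so that there the field is conjugate to the trace-free part `2 N` of the monodromy
`1 + N`. -/
theorem exists_isKilling (hn : ∀ w ∈ U, w + 2 * Real.pi * Complex.I * n ∈ U)
    (hP : ∀ w ∈ U, F (w + 2 * Real.pi * Complex.I * n) l *
      polarPart c B (w + 2 * Real.pi * Complex.I * n) *
        (F (w + 2 * Real.pi * Complex.I * n) l).adjugate =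
      F w l * polarPart c B w * (F w l).adjugate)
    {N : Loop} (hN : ∀ l, N l * N l = 0) (hNl : N l ≠ 0)
    (hLN : ∀ l, ∀ w ∈ U, L (w + 2 * Real.pi * Complex.I * n) l = (1 + N l) * L w l)
    {w₀ : ℂ} (hw₀ : w₀ ∈ U) :
    ∃ (X : ℂ → CircMat) (Z : Loop), IsKilling c U X ∧ X w₀ ≠ 0 ∧ (∀ l, (Z l).trace = 0) ∧
      ∀ w ∈ U, ∀ l, (X w).map (ev l) = (L w l).adjugate * Z l * L w l := by
  set τ : ℂ := 2 * Real.pi * Complex.I * n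
  set K : Loop := fun l' =>
    (relFrame F l l' (w₀ + τ) * (relFrame F l l' w₀).adjugate).adjugate * (1 + N l') with hK
  set X : ℂ → CircMat := fun w => periodField F B l τ w - (periodField F B l τ w).adjugate
  have hX : ∀ w ∈ U, ∀ l',
      (X w).map (ev l') = (L w l').adjugate * (K l' - (K l').adjugate) * L w l' := fun w hw l' => by
    have hconst := D.relFrame_add_period_mul_adjugate l l' hn hP hw hw₀
    have hH : (periodField F B l τ w).map (ev l') = (L w l').adjugate * K l' * L w l' := by
      rw [D.map_ev_periodField hw (hn w hw), hconst, hLN l' w hw]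
      simp only [hK, mul_assoc]
    rw [map_ev_sub, map_ev_adjugate, hH]
    simp only [adjugate_mul_distrib, adjugate_adjugate_fin_two, mul_sub, sub_mul, mul_assoc]
  have htr : ∀ l', (K l' - (K l').adjugate).trace = 0 := fun l' => by
    simp [adjugate_fin_two, trace_fin_two, add_comm]
  refine ⟨X, _, D.isKilling_of_conj (fun w hw => ?_) htr hX, fun h0 => hNl ?_, htr, hX⟩
  · have hmem := D.periodField_mem hw (hn w hw) l
    exact diskMat.sub_mem hmem (adjugate_mem_diskMat hmem)
  · have hKl : K l - (K l).adjugate = (2 : ℂ) • N l := by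
      have hadj := adjugate_eq_neg_of_trace_eq_zero (trace_eq_zero_of_mul_self_eq_zero (hN l))
      simp only [hK, D.relFrame_self hw₀, D.relFrame_self (hn w₀ hw₀), adjugate_one, one_mul,
        adjugate_add_fin_two, hadj, two_smul]
      abel
    have h := congrArg (fun M => L w₀ l * M * (L w₀ l).adjugate) (hX w₀ hw₀ l)
    simp only [h0, hKl, mul_conj_mul_adjugate (D.det_L hw₀ l), Matrix.map_zero _ (map_zero (ev l)),
      mul_zero, zero_mul] at h
    exact (smul_eq_zero.1 h.symm).resolve_left two_ne_zero

theorem not_conj_polarPart_periodic (hne : U.Nonempty) (hn₀ : n ≠ 0)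
    (hn : ∀ w ∈ U, w + 2 * Real.pi * Complex.I * n ∈ U) :
    ¬∀ w ∈ U, F (w + 2 * Real.pi * Complex.I * n) l *
      polarPart c B (w + 2 * Real.pi * Complex.I * n) *
        (F (w + 2 * Real.pi * Complex.I * n) l).adjugate =
      F w l * polarPart c B w * (F w l).adjugate := by
  intro hP
  choose N hN0 hNN hLN using fun l => exists_nilpotent_monodromy D.c_ne_zero D.isOpen
    D.isPreconnected hne (fun w hw => D.hasDerivAt w hw l) (fun w hw => D.det_L hw l) hn₀ hn
  obtain ⟨w, hw⟩ := hne
  obtain ⟨X, Z, hX, hX0, hZ, hXZ⟩ := D.exists_isKilling hn hP hNN (hN0 l) hLN hw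
  have hcomm := hX.commute (hX.add_period hn) D.c_ne_zero D.isOpen D.isPreconnected hw
  obtain ⟨l', hdet⟩ := hX.exists_det_ne_zero D.c_ne_zero D.isOpen D.isPreconnected hw hX0
  refine hN0 l' (eq_zero_of_commute_conj (hZ l') ?_ (hNN l') ?_)
  · rw [hXZ w hw, det_mul, det_mul, det_adjugate, D.det_L hw] at hdet
    simpa using hdet
  · have hadj := adjugate_eq_neg_of_trace_eq_zero (trace_eq_zero_of_mul_self_eq_zero (hNN l'))
    have hXτ : (X (w + 2 * Real.pi * Complex.I * n)).map (ev l') =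
        (L w l').adjugate * ((1 - N l') * Z l' * (1 + N l')) * L w l' := by
      rw [hXZ _ (hn w hw), hLN l' w hw, adjugate_mul_distrib, adjugate_add_fin_two, adjugate_one,
        hadj, ← sub_eq_add_neg]
      simp only [mul_assoc]
    have h := congrArg (fun M : CircMat => L w l' * M.map (ev l') * (L w l').adjugate) hcomm.eq
    rw [Commute, SemiconjBy]
    simpa only [map_ev_mul, hXZ w hw, hXτ, conj_mul_conj (D.det_L hw l'),
      mul_conj_mul_adjugate (D.det_L hw l')] using h

end IsSplitting

/-! ### The second Iwasawa cell and the universal cover -/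

theorem trace_omega (l : Circle) : (omega l).trace = 0 := by simp [omega, trace_fin_two]

theorem det_omega (l : Circle) : (omega l).det = 1 := by simp [omega, det_fin_two]

theorem inv_omega (l : Circle) : (omega l)⁻¹ = -omega l := by
  rw [inv_eq_adjugate (det_omega l), adjugate_eq_neg_of_trace_eq_zero (trace_omega l)]

theorem isTwisted_omega : IsTwisted omega := by
  intro l
  have h : ((Circle.exp Real.pi : Circle) : ℂ) = -1 := by simp [Circle.coe_exp]
  simp [omega, h, inv_neg]

theorem IsSmoothFamily.mul {U : Set ℂ} {F G : ℂ → Loop} (hF : IsSmoothFamily U F)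
    (hG : IsSmoothFamily U G) : IsSmoothFamily U fun w l => F w l * G w l := by
  intro i j
  simp only [mul_apply, Fin.sum_univ_two]
  exact ((hF i 0).mul (hG 0 j)).add ((hF i 1).mul (hG 1 j))

theorem isSmoothFamily_omega (U : Set ℂ) : IsSmoothFamily U fun _ => omega := by
  have hexp : ContDiff ℝ ∞ fun p : ℂ × ℝ => ((Circle.exp p.2 : Circle) : ℂ) := by
    simp only [Circle.coe_exp]
    exact Complex.contDiff_exp.comp
      ((Complex.ofRealCLM.contDiff.comp contDiff_snd).mul contDiff_const)
  intro i j
  fin_cases i <;> fin_cases j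
  · exact contDiffOn_const
  · exact hexp.neg.contDiffOn
  · exact (hexp.inv fun p => Circle.coe_ne_zero _).contDiffOn
  · exact contDiffOn_const

theorem IsFrame.exists_isSplitting {T : SurfaceClass} {c : ℂ} (hc : c ≠ 0) {U V : Set ℂ}
    (hVU : V ⊆ U) (hV : IsOpen V) (hVc : IsPreconnected V) {L F : ℂ → Loop}
    (hL : IsSolution c U L) (hF : IsFrame T U L F) :
    ∃ L' F' B : ℂ → Loop, IsSplitting T c V L' F' B ∧ ∀ w ∈ V, F' w = F w := by
  obtain ⟨F₀, B, hsm, hre, hpos, hcase⟩ := hF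
  have hd : ∀ w ∈ V, ∀ l : Circle,
      HasDerivAt (fun v => L v l) (L w l * ((l : ℂ)⁻¹ • xiMat c w)) w := fun w hw l => by
    rw [← exp_smul_potential]
    exact hasDerivAt_matrix.2 (hL.2 w (hVU hw) l)
  have hsm' : IsSmoothFamily V F₀ := fun i j => (hsm i j).mono (Set.prod_mono hVU subset_rfl)
  have htw : ∀ w ∈ V, IsTwisted (F₀ w) := fun w hw => (hre w (hVU hw)).1.2.1
  have hdet : ∀ w ∈ V, ∀ l, (F₀ w l).det = 1 := fun w hw => (hre w (hVU hw)).1.2.2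
  have hreal : ∀ w ∈ V, ∀ l, reality T (F₀ w l) = F₀ w l := fun w hw l =>
    reality_eq_of_mem_realForm ((hre w (hVU hw)).2 l)
  have hB : ∀ w ∈ V, B w ∈ loopPlus := fun w hw => hpos w (hVU hw)
  rcases hcase with h | ⟨rfl, h⟩
  · exact ⟨L, F₀, B, ⟨hV, hVc, hc, hd, hsm', htw, hdet, hreal, hB,
      fun w hw l => (h w (hVU hw) l).1⟩,
      fun w hw => funext fun l => (h w (hVU hw) l).2.symm⟩
  · refine ⟨fun w l => (omega l)⁻¹ * L w l, fun w l => (omega l)⁻¹ * F₀ w l * omega l, B,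
      ⟨hV, hVc, hc, fun w hw l => ?_, ?_, fun w hw => ?_, fun w hw l => ?_, fun w hw l => ?_, hB,
        fun w hw l => ?_⟩, fun w hw => funext fun l => (h w (hVU hw) l).2.symm⟩
    · rw [mul_assoc]
      exact (hd w hw l).const_mul _
    · simp only [inv_omega, neg_mul]
      exact fun i j => (((isSmoothFamily_omega V).mul hsm').mul (isSmoothFamily_omega V) i j).neg
    · simp only [inv_eq_adjugate (det_omega _)]
      exact (isTwisted_omega.adjugate.mul (htw w hw)).mul isTwisted_omega
    · rw [inv_eq_adjugate (det_omega l), det_mul, det_mul, det_adjugate, hdet w hw, det_omega]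
      simp
    · simp only [inv_omega, reality_mul, reality_neg, reality_omega, hreal w hw, neg_neg, neg_mul,
        mul_neg]
    · rw [(h w (hVU hw) l).1]
      simp only [mul_assoc]

theorem add_period_mem_logCover {S : Set ℂ} {w : ℂ} (hw : w ∈ logCover S) (n : ℤ) :
    w + 2 * Real.pi * Complex.I * n ∈ logCover S := by
  rw [logCover, Set.mem_preimage, exp_add_two_pi_mul_I_mul_int]
  exact hw

/-- The component is that of a logarithm of `γ`, which joins a point to its translate. -/
theorem exists_component_logCover {S : Set ℂ} (hS : IsOpen S) {z : ℂ} {γ : Path z z} {n : ℤ}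
    (hγ : ∀ t, γ t ∈ S) (hn : HasWindingNumber γ n) :
    ∃ V ⊆ logCover S, IsOpen V ∧ IsPreconnected V ∧ V.Nonempty ∧
      ∀ w ∈ V, w + 2 * Real.pi * Complex.I * n ∈ V := by
  obtain ⟨θ, hθ, hθn⟩ := hn
  have hmem : ∀ t, θ t ∈ logCover S := fun t => by
    rw [logCover, Set.mem_preimage, hθ]
    exact hγ t
  refine ⟨connectedComponentIn (logCover S) (θ 0), connectedComponentIn_subset _ _,
    (hS.preimage Complex.continuous_exp).connectedComponentIn, isPreconnected_connectedComponentIn,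
    ⟨θ 0, mem_connectedComponentIn (hmem 0)⟩, fun w hw => ?_⟩
  have hθ1 : θ 1 ∈ connectedComponentIn (logCover S) (θ 0) :=
    (isPreconnected_range θ.continuous).subset_connectedComponentIn (Set.mem_range_self 0)
      (Set.range_subset_iff.2 hmem) (Set.mem_range_self 1)
  have hshift : (fun w => w + 2 * Real.pi * Complex.I * n) ''
      connectedComponentIn (logCover S) (θ 0) ⊆ connectedComponentIn (logCover S) (θ 1) := by
    refine (isPreconnected_connectedComponentIn.image _
      (by fun_prop)).subset_connectedComponentIn ?_ ?_
    · exact ⟨θ 0, mem_connectedComponentIn (hmem 0), (sub_eq_iff_eq_add'.1 hθn).symm⟩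
    · rintro _ ⟨w, hw, rfl⟩
      exact add_period_mem_logCover (connectedComponentIn_subset _ _ hw) n
  rw [connectedComponentIn_eq hθ1]
  exact hshift ⟨w, hw, rfl⟩

end DPW

end

theorem theorem4p1_general (T : DPW.SurfaceClass) {c : ℂ} (hc : c ≠ 0) {H : ℝ} (hH : H ≠ 0)
    {S : Set ℂ} (hS : IsOpen S)
    (hwind : ∃ (z : ℂ) (γ : Path z z) (n : ℤ), (∀ t, γ t ∈ S) ∧ DPW.HasWindingNumber γ n ∧ n ≠ 0)
    {L F : ℂ → DPW.Loop} (hL : DPW.IsSolution c (DPW.logCover S) L)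
    (hF : DPW.IsFrame T (DPW.logCover S) L F) (l : Circle) :
    ¬DPW.IsWellDefinedOn S (fun w => DPW.symMap H T (F w) l) := by
  rintro ⟨fS, hfS : ∀ w ∈ DPW.logCover S, DPW.symMap H T (F w) l = fS (Complex.exp w)⟩
  obtain ⟨z, γ, n, hγ, hγn, hn⟩ := hwind
  obtain ⟨V, hVS, hV, hVc, hVne, hVn⟩ := DPW.exists_component_logCover hS hγ hγn
  obtain ⟨L', F', B, D, hF'⟩ := hF.exists_isSplitting hc hVS hV hVc hL
  refine D.not_conj_polarPart_periodic hVne hn hVn fun w hw =>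
    D.conj_polarPart_add_period hw l hH hVn fun w hw => ?_
  rw [hF' w hw, hF' _ (hVn w hw), hfS _ (hVS hw), hfS _ (hVS (hVn w hw)),
    DPW.exp_add_two_pi_mul_I_mul_int]

theorem theorem4p1 (T : DPW.SurfaceClass) (c : ℂ) (hc : c ≠ 0) (H : ℝ) (hH : H ≠ 0)
    (S : Set ℂ) (hS : DPW.IsAnnularAroundZero S)
    (L F : ℂ → DPW.Loop)
    (hL : DPW.IsSolution c (DPW.logCover S) L)
    (hF : DPW.IsFrame T (DPW.logCover S) L F)
    (l : Circle)
    (himm : T = DPW.SurfaceClass.cgcTimelike →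
      DPW.IsImmersionOn (DPW.logCover S) (fun w => DPW.symMap H T (F w) l)) :
    ¬ DPW.IsWellDefinedOn S (fun w => DPW.symMap H T (F w) l) := by
  obtain ⟨hSo, -, -, hwind⟩ := hS
  exact theorem4p1_general T hc hH hSo hwind hL hF l
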